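/- Given $D\ge 1$, an infinite separable metric space $(M,d)$ is said to embed into a normed space $(Z,\|\cdot\|_Z)$ with quadratic average distortion $D$ if for every Borel probability measure $\mu$ on $M$ there is a $D$-Lipschitz map $f=f_\mu:M\to Z$ such that $$\iint_{M\times M}\|f(x)-f(y)\|_Z^2\,d\mu(x)\,d\mu(y)\ \ge\ \iint_{M\times M}d(x,y)^2\,d\mu(x)\,d\mu(y)$$ (both integrals take values in $[0,\infty]$). The $\frac12$-snowflake of $(M,d)$ is the metric space $(M,\sqrt{d}\,)$. **Theorem.** There is a universal constant $\mathsf{C}>0$ such that for every integer $k\ge 2$ and every real normed space $X$ of dimension $k$, the $\frac12$-snowflake of $X$ embeds into some Hilbert space with quadratic average distortion $\mathsf{C}\sqrt{\log k}$. This bound is sharp up to the value of the constant: there is a universal constant $c>0$ such that for every integer $k\ge 2$, if the $\frac12$-snowflake of $\ell_\infty^k$ embeds into a Hilbert space with quadratic average distortion $D\ge 1$, then $D\ge c\sqrt{\log k}$. -/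

import Mathlib

open MeasureTheory

universe u v

/-- For `1 ≤ D`, the (infinite) metric space `M` embeds into the normed space `Z` with quadratic
average distortion `D`: for every Borel probability measure `μ` on `M` there is a `D`-Lipschitz
map `f : M → Z`, which may depend on `μ`, such that
`∬ ‖f x - f y‖² dμ(x) dμ(y) ≥ ∬ d(x, y)² dμ(x) dμ(y)`.
The integrals take values in `[0, ∞]`, and no moment assumption is made on `μ`. -/
def EmbedsWithQuadraticAverageDistortion (M Z : Type*) [MetricSpace M] [NormedAddCommGroup Z]
    (D : ℝ) : Prop :=
  1 ≤ D ∧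
    ∀ [MeasurableSpace M] [BorelSpace M] (μ : Measure M) [IsProbabilityMeasure μ],
      ∃ f : M → Z, LipschitzWith D.toNNReal f ∧
        ∫⁻ y, ∫⁻ x, edist x y ^ 2 ∂μ ∂μ ≤ ∫⁻ y, ∫⁻ x, ‖f x - f y‖ₑ ^ 2 ∂μ ∂μ

/-- The `1/2`-snowflake of a metric space `M`: the set `M` with the metric `d(x, y) ^ (1/2)`. -/
abbrev HalfSnowflake (M : Type*) : Type _ :=
  Metric.Snowflaking M (1 / 2 : ℝ) one_half_pos one_half_lt_one.le

/-!
For the upper bound, consider a stationary Markov chain with weights `μ` and transition matrix `P`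
on a finite set, and points `x i` of a normed space `X` of dimension `k ≥ 2`. By Auerbach's lemma
`X` is `k`-isomorphic to `ℓ₁^k`, so `L²` contraction of mean-zero real functions by `P ^ t` passes
to `X`-valued functions at the cost of a power of `k`, which is compensated by taking `t` of
order `log k` over the spectral gap. Applied to the images of the points under the Mazur map
`x ↦ x / √‖x‖`, whose squared distances are at most a constant times the distances in `X`, and
on average around the mean at least a constant times them (`sum_sum_norm_sub_le_mazurMap`), and
combined with the triangle inequality along `t` steps, this gives the nonlinear Poincaré inequality
`∑ μ i μ j ‖x i - x j‖ ≲ (log k / gap) ∑ μ i P i j ‖x i - x j‖`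
(`IsStationaryChain.sum_sum_norm_sub_le`, `mul_sum_sum_norm_sub_le_log`). That the distances enter
to the first power is what makes the loss `log k` for squared distances in the snowflake, and so
`√(log k)` for the distortion.

By Hahn–Banach separation, these inequalities for all weights yield, for each probability vector on
finitely many points, a positive semidefinite kernel whose squared distances are at most
`O(log k) ‖x i - x j‖` and which does not decrease the average
(`exists_posSemidef_kernelSqDist_le_of_sum_eq_one`). An ultrafilter limit over finite sets gives a
kernel on the whole space, and the reproducing kernel construction turns it into a map to a Hilbert
space. The one space `KernelSum I` serves all kernels, so that the target does not depend on the
measure. A Borel probability measure of finite first moment is approximated by a finitely supported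
one; for infinite first moment the scalar map `x ↦ √‖x‖` suffices.

For the lower bound, `8 m` random generators of `(ℤ/2)^m` give a Cayley graph with a spectral gap
bounded below (`exists_generators`), so in a Hilbert space the average squared distance of two
vertices is at most a constant times the average squared length of an edge
(`sum_sum_norm_sub_sq_le_of_generators`). Most pairs of vertices are at a distance of order `m` in
the graph, and the translates of the truncated word length embed it in `ℓ_∞^k` for `2 ^ m ≤ k`,
with edges of length at most one and average distance of order `m ≈ log k`.
-/

/-! ### Auerbach bases -/

/-- **Auerbach's lemma**, in dual form: a `k`-dimensional normed space carries `k` functionals of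
norm at most one whose absolute values sum to at least the norm. The functionals are the
coordinates of a tuple of vectors in the unit ball that maximises `|det|`. -/
theorem exists_auerbach_functionals {X : Type*} [NormedAddCommGroup X] [NormedSpace ℝ X]
    [FiniteDimensional ℝ X] {k : ℕ} (hk : Module.finrank ℝ X = k) :
    ∃ l : Fin k → X →ₗ[ℝ] ℝ, (∀ i x, |l i x| ≤ ‖x‖) ∧ ∀ x, ‖x‖ ≤ ∑ i, |l i x| := by
  classical
  let e : Module.Basis (Fin k) ℝ X := Module.finBasisOfFinrankEq ℝ X hk
  have hcont : Continuous fun v : Fin k → X => |e.det v| := by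
    refine Continuous.abs ?_
    rw [show (⇑e.det : (Fin k → X) → ℝ) = fun v => (e.toMatrix v).det from
      funext e.det_apply]
    refine Continuous.matrix_det (continuous_matrix fun i j => ?_)
    exact (e.coord i).continuous_of_finiteDimensional.comp (continuous_apply j)
  have : ProperSpace X := FiniteDimensional.proper_real X
  have hcomp : IsCompact (Set.univ.pi fun _ : Fin k => Metric.closedBall (0 : X) 1) :=
    isCompact_univ_pi fun _ => isCompact_closedBall 0 1
  obtain ⟨v, hv, hmax⟩ := hcomp.exists_isMaxOn
    ⟨0, fun i _ => by simp⟩ hcont.continuousOn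
  have hv1 : ∀ i, ‖v i‖ ≤ 1 := fun i => by simpa using hv i (Set.mem_univ i)
  have hdet : e.det v ≠ 0 := by
    have hw : (fun i => (‖e i‖)⁻¹ • e i) ∈
        (Set.univ.pi fun _ : Fin k => Metric.closedBall (0 : X) 1) := by
      intro i _
      simp [norm_smul, inv_mul_cancel₀ (norm_ne_zero_iff.2 (e.ne_zero i))]
    have h1 : |e.det fun i => (‖e i‖)⁻¹ • e i| ≤ |e.det v| := hmax hw
    have h2 : e.det (fun i => (‖e i‖)⁻¹ • e i) = ∏ i, (‖e i‖)⁻¹ := by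
      rw [AlternatingMap.map_smul_univ, e.det_self]; simp
    have h3 : 0 < ∏ i, (‖e i‖)⁻¹ :=
      Finset.prod_pos fun i _ => inv_pos.2 (norm_pos_iff.2 (e.ne_zero i))
    intro h0
    rw [h2, h0, abs_zero] at h1
    exact absurd h1 (not_le.2 (abs_pos.2 h3.ne'))
  let l : Fin k → X →ₗ[ℝ] ℝ := fun i =>
    (e.det v)⁻¹ • e.det.toMultilinearMap.toLinearMap v i
  have hl : ∀ i x, l i x = (e.det v)⁻¹ * e.det (Function.update v i x) := fun i x => rfl
  have hunit : ∀ i x, ‖x‖ ≤ 1 → |l i x| ≤ 1 := by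
    intro i x hx
    have hw : Function.update v i x ∈
        (Set.univ.pi fun _ : Fin k => Metric.closedBall (0 : X) 1) := by
      intro j _
      rcases eq_or_ne j i with rfl | h
      · simpa using hx
      · simpa [h] using hv1 j
    have h1 : |e.det (Function.update v i x)| ≤ |e.det v| := hmax hw
    rw [hl, abs_mul, abs_inv, inv_mul_le_iff₀ (abs_pos.2 hdet), mul_one]
    exact h1
  have hle : ∀ i x, |l i x| ≤ ‖x‖ := by
    intro i x
    rcases eq_or_ne x 0 with rfl | hx
    · simp
    have hx' := norm_pos_iff.2 hx
    have := hunit i (‖x‖⁻¹ • x) (by simp [norm_smul, inv_mul_cancel₀ hx'.ne'])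
    rw [map_smul, smul_eq_mul, abs_mul, abs_inv, abs_norm, inv_mul_le_iff₀ hx', mul_one] at this
    exact this
  obtain ⟨hli, hsp⟩ := e.is_basis_iff_det.2 (isUnit_iff_ne_zero.2 hdet)
  let b : Module.Basis (Fin k) ℝ X := Module.Basis.mk hli hsp.ge
  have hb : ∀ j, b j = v j := fun j => by simp [b]
  have hdual : ∀ i j, l i (v j) = if i = j then 1 else 0 := by
    intro i j
    split_ifs with h
    · subst h; rw [hl, Function.update_eq_self, inv_mul_cancel₀ hdet]
    · rw [hl, AlternatingMap.map_update_self _ _ h, mul_zero]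
  have hsum : (∑ i, (l i).smulRight (v i)) = LinearMap.id := by
    refine b.ext fun j => ?_
    simp [hb, hdual]
  refine ⟨l, hle, fun x => ?_⟩
  have hx : x = ∑ i, l i x • v i := by
    have := congrArg (fun T : X →ₗ[ℝ] X => T x) hsum
    simpa using this.symm
  calc ‖x‖ = ‖∑ i, l i x • v i‖ := by rw [← hx]
    _ ≤ ∑ i, ‖l i x • v i‖ := norm_sum_le _ _
    _ ≤ ∑ i, |l i x| := Finset.sum_le_sum fun i _ => by
        rw [norm_smul, Real.norm_eq_abs]
        exact mul_le_of_le_one_right (abs_nonneg _) (hv1 i)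

/-! ### The Mazur map -/

/-- The Mazur map `x ↦ x / √‖x‖`, which satisfies `‖mazurMap x‖² = ‖x‖`. Its value at `0` is `0`. -/
noncomputable def mazurMap {X : Type*} [NormedAddCommGroup X] [NormedSpace ℝ X] (x : X) : X :=
  (√‖x‖)⁻¹ • x

section Mazur

variable {X : Type*} [NormedAddCommGroup X] [NormedSpace ℝ X]

theorem norm_mazurMap (x : X) : ‖mazurMap x‖ = √‖x‖ := by
  rcases eq_or_ne x 0 with rfl | hx
  · simp [mazurMap]
  have hx' := Real.sqrt_pos.2 (norm_pos_iff.2 hx)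
  rw [mazurMap, norm_smul, norm_inv, Real.norm_of_nonneg hx'.le, inv_mul_eq_div, Real.div_sqrt]

theorem norm_mazurMap_sq (x : X) : ‖mazurMap x‖ ^ 2 = ‖x‖ := by
  rw [norm_mazurMap, Real.sq_sqrt (norm_nonneg x)]

theorem norm_smul_mazurMap (x : X) : ‖mazurMap x‖ • mazurMap x = x := by
  rcases eq_or_ne x 0 with rfl | hx
  · simp [mazurMap]
  have hx' := Real.sqrt_pos.2 (norm_pos_iff.2 hx)
  rw [norm_mazurMap, mazurMap, smul_smul, mul_inv_cancel₀ hx'.ne', one_smul]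

/-- The Mazur map is `1/2`-Hölder. -/
theorem norm_mazurMap_sub_sq_le (x y : X) : ‖mazurMap x - mazurMap y‖ ^ 2 ≤ 6 * ‖x - y‖ := by
  wlog h : ‖y‖ ≤ ‖x‖ generalizing x y
  · have := this y x (le_of_not_ge h)
    rwa [norm_sub_rev, norm_sub_rev x]
  rcases eq_or_ne x 0 with rfl | hx
  · have hy : y = 0 := by simpa using h
    simp [hy]
  set a := √‖x‖ with ha
  set b := √‖y‖ with hb
  set c := √‖x - y‖ with hc
  have ha0 : 0 < a := Real.sqrt_pos.2 (norm_pos_iff.2 hx)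
  have hb0 : 0 ≤ b := Real.sqrt_nonneg _
  have hc0 : 0 ≤ c := Real.sqrt_nonneg _
  have ha2 : a ^ 2 = ‖x‖ := Real.sq_sqrt (norm_nonneg _)
  have hb2 : b ^ 2 = ‖y‖ := Real.sq_sqrt (norm_nonneg _)
  have hc2 : c ^ 2 = ‖x - y‖ := Real.sq_sqrt (norm_nonneg _)
  have hba : b ≤ a := Real.sqrt_le_sqrt h
  have htri1 : a ^ 2 ≤ b ^ 2 + c ^ 2 := by
    rw [ha2, hb2, hc2]; linarith [norm_sub_norm_le x y]
  have htri2 : c ^ 2 ≤ a ^ 2 + b ^ 2 := by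
    rw [ha2, hb2, hc2]; exact norm_sub_le x y
  have hdiff : a - b ≤ c := by nlinarith
  have hdecomp : a • (mazurMap x - mazurMap y) = (x - y) + (b - a) • mazurMap y := by
    have h1 : a • mazurMap x = x := by rw [ha, ← norm_mazurMap]; exact norm_smul_mazurMap x
    have h2 : b • mazurMap y = y := by rw [hb, ← norm_mazurMap]; exact norm_smul_mazurMap y
    rw [smul_sub, h1, sub_smul, h2]; abel
  have hn : a * ‖mazurMap x - mazurMap y‖ ≤ c ^ 2 + (a - b) * b := by
    have h3 := norm_add_le (x - y) ((b - a) • mazurMap y)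
    rw [← hdecomp, norm_smul, norm_smul, norm_mazurMap, Real.norm_of_nonneg ha0.le,
      Real.norm_eq_abs, abs_sub_comm, abs_of_nonneg (sub_nonneg.2 hba)] at h3
    rw [hc2]; exact h3
  have hn0 := norm_nonneg (mazurMap x - mazurMap y)
  set s := ‖mazurMap x - mazurMap y‖
  rw [← hc2]
  -- `c ≤ √2 a` and `(a - b) b ≤ c a`, so that `s ≤ (1 + √2) c` and `(1 + √2)² ≤ 6`
  have hca : c ≤ 1.42 * a := by
    refine le_of_sq_le_sq ?_ (by positivity)
    nlinarith
  have hs : a * s ≤ a * (2.42 * c) := by nlinarith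
  have hs' : s ≤ 2.42 * c := le_of_mul_le_mul_left hs ha0
  nlinarith

theorem norm_sub_le_mazurMap (x y : X) :
    ‖x - y‖ ≤ ‖mazurMap x - mazurMap y‖ * (‖mazurMap x‖ + ‖mazurMap y‖) := by
  set u := mazurMap x with hu
  set w := mazurMap y with hw
  have h : x - y = ‖u‖ • (u - w) + (‖u‖ - ‖w‖) • w := by
    conv_lhs => rw [← norm_smul_mazurMap x, ← norm_smul_mazurMap y, ← hu, ← hw]
    rw [smul_sub, sub_smul]; abel
  calc ‖x - y‖ ≤ ‖‖u‖ • (u - w)‖ + ‖(‖u‖ - ‖w‖) • w‖ := by rw [h]; exact norm_add_le _ _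
    _ = ‖u‖ * ‖u - w‖ + |‖u‖ - ‖w‖| * ‖w‖ := by
        rw [norm_smul, norm_smul, norm_norm, Real.norm_eq_abs]
    _ ≤ ‖u‖ * ‖u - w‖ + ‖u - w‖ * ‖w‖ := by
        gcongr; exact abs_norm_sub_norm_le u w
    _ = _ := by ring

end Mazur

/-! ### Markov chains in a finite-dimensional normed space -/

/-- `P` is the transition matrix of a Markov chain on the finite state space `ι` for which the
probability vector `μ` is stationary. -/
structure IsStationaryChain {ι : Type*} [Fintype ι] (μ : ι → ℝ) (P : Matrix ι ι ℝ) : Prop where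
  weight_nonneg : ∀ i, 0 ≤ μ i
  sum_weight : ∑ i, μ i = 1
  nonneg : ∀ i j, 0 ≤ P i j
  row_sum : ∀ i, ∑ j, P i j = 1
  stationary : ∀ j, ∑ i, μ i * P i j = μ j

theorem sum_sum_mul_sq_le {ι : Type*} [Fintype ι] (a r s : ι → ι → ℝ) (ha : ∀ i j, 0 ≤ a i j) :
    (∑ i, ∑ j, a i j * (r i j * s i j)) ^ 2 ≤
      (∑ i, ∑ j, a i j * r i j ^ 2) * ∑ i, ∑ j, a i j * s i j ^ 2 := by
  simp only [← Fintype.sum_prod_type']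
  exact Finset.sum_sq_le_sum_mul_sum_of_sq_le_mul _
    (fun p _ => mul_nonneg (ha _ _) (sq_nonneg _)) (fun p _ => mul_nonneg (ha _ _) (sq_nonneg _))
    fun p _ => le_of_eq (by ring)

/-- For a center of mass at the origin, the Mazur map distorts average distances, measured by
squares on the Hilbertian side, by a constant factor only. -/
theorem sum_sum_norm_sub_le_mazurMap {ι : Type*} [Fintype ι] {X : Type*}
    [NormedAddCommGroup X] [NormedSpace ℝ X] {μ : ι → ℝ} (hμ : ∀ i, 0 ≤ μ i) (h1 : ∑ i, μ i = 1)
    (y : ι → X) (hy : ∑ i, μ i • y i = 0) :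
    ∑ i, ∑ j, μ i * μ j * ‖y i - y j‖ ≤
      4 * ∑ i, ∑ j, μ i * μ j * ‖mazurMap (y i) - mazurMap (y j)‖ ^ 2 := by
  set u : ι → X := fun i => mazurMap (y i) with hu
  set S := ∑ i, ∑ j, μ i * μ j * ‖y i - y j‖ with hS
  set Q := ∑ i, ∑ j, μ i * μ j * ‖u i - u j‖ ^ 2 with hQ
  have hμμ : ∀ i j, 0 ≤ μ i * μ j := fun i j => mul_nonneg (hμ i) (hμ j)
  have hS0 : 0 ≤ S := Finset.sum_nonneg fun i _ => Finset.sum_nonneg fun j _ =>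
    mul_nonneg (hμμ i j) (norm_nonneg _)
  have hQ0 : 0 ≤ Q := Finset.sum_nonneg fun i _ => Finset.sum_nonneg fun j _ =>
    mul_nonneg (hμμ i j) (sq_nonneg _)
  have hcenter : ∑ i, μ i * ‖y i‖ ≤ S := by
    refine Finset.sum_le_sum fun i _ => ?_
    simp only [mul_assoc]
    rw [← Finset.mul_sum]
    refine mul_le_mul_of_nonneg_left ?_ (hμ i)
    have h2 : y i = ∑ j, μ j • (y i - y j) := by
      simp only [smul_sub, Finset.sum_sub_distrib, ← Finset.sum_smul, h1, one_smul, hy, sub_zero]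
    calc ‖y i‖ = ‖∑ j, μ j • (y i - y j)‖ := by rw [← h2]
      _ ≤ ∑ j, ‖μ j • (y i - y j)‖ := norm_sum_le _ _
      _ = _ := Finset.sum_congr rfl fun j _ => by rw [norm_smul, Real.norm_of_nonneg (hμ j)]
  have hsum : ∑ i, ∑ j, μ i * μ j * (‖u i‖ + ‖u j‖) ^ 2 ≤ 4 * ∑ i, μ i * ‖y i‖ := by
    have h3 : ∑ i, ∑ j, μ i * μ j * (2 * ‖y i‖ + 2 * ‖y j‖) = 4 * ∑ i, μ i * ‖y i‖ := by
      have e1 : ∑ i, ∑ j, μ i * μ j * (2 * ‖y i‖) = 2 * ∑ i, μ i * ‖y i‖ := by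
        rw [Finset.mul_sum]
        refine Finset.sum_congr rfl fun i _ => ?_
        rw [← Finset.sum_mul, ← Finset.mul_sum, h1]; ring
      have e2 : ∑ i, ∑ j, μ i * μ j * (2 * ‖y j‖) = 2 * ∑ i, μ i * ‖y i‖ := by
        rw [Finset.sum_comm, ← e1]
        exact Finset.sum_congr rfl fun i _ => Finset.sum_congr rfl fun j _ => by ring
      simp only [mul_add, Finset.sum_add_distrib, e1, e2]; ring
    rw [← h3]
    refine Finset.sum_le_sum fun i _ => Finset.sum_le_sum fun j _ =>
      mul_le_mul_of_nonneg_left ?_ (hμμ i j)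
    have e3 : ‖u i‖ ^ 2 = ‖y i‖ := norm_mazurMap_sq _
    have e4 : ‖u j‖ ^ 2 = ‖y j‖ := norm_mazurMap_sq _
    nlinarith [sq_nonneg (‖u i‖ - ‖u j‖)]
  have hle : S ≤ ∑ i, ∑ j, μ i * μ j * (‖u i - u j‖ * (‖u i‖ + ‖u j‖)) :=
    Finset.sum_le_sum fun i _ => Finset.sum_le_sum fun j _ =>
      mul_le_mul_of_nonneg_left (norm_sub_le_mazurMap _ _) (hμμ i j)
  have hsq : S ^ 2 ≤ Q * (4 * S) :=
    (pow_le_pow_left₀ hS0 hle 2).trans ((sum_sum_mul_sq_le _ _ _ hμμ).trans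
      (mul_le_mul_of_nonneg_left (hsum.trans (by linarith)) hQ0))
  by_contra hcon
  push Not at hcon
  nlinarith

namespace IsStationaryChain

variable {ι : Type*} [Fintype ι] {μ : ι → ℝ} {P : Matrix ι ι ℝ}

theorem one [DecidableEq ι] (hμ : ∀ i, 0 ≤ μ i) (h1 : ∑ i, μ i = 1) :
    IsStationaryChain μ (1 : Matrix ι ι ℝ) where
  weight_nonneg := hμ
  sum_weight := h1
  nonneg i j := by rw [Matrix.one_apply]; split_ifs <;> norm_num
  row_sum i := by simp [Matrix.one_apply]
  stationary j := by simp [Matrix.one_apply]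

theorem mul {Q : Matrix ι ι ℝ} (hP : IsStationaryChain μ P) (hQ : IsStationaryChain μ Q) :
    IsStationaryChain μ (P * Q) where
  weight_nonneg := hP.weight_nonneg
  sum_weight := hP.sum_weight
  nonneg i j := by
    rw [Matrix.mul_apply]
    exact Finset.sum_nonneg fun l _ => mul_nonneg (hP.nonneg i l) (hQ.nonneg l j)
  row_sum i := by
    simp only [Matrix.mul_apply]
    rw [Finset.sum_comm]
    simp only [← Finset.mul_sum, hQ.row_sum, mul_one, hP.row_sum]
  stationary j := by
    simp only [Matrix.mul_apply, Finset.mul_sum]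
    rw [Finset.sum_comm]
    simp only [← mul_assoc, ← Finset.sum_mul, hP.stationary, hQ.stationary]

theorem pow [DecidableEq ι] (hP : IsStationaryChain μ P) (t : ℕ) : IsStationaryChain μ (P ^ t) := by
  induction t with
  | zero => simpa using one hP.weight_nonneg hP.sum_weight
  | succ t ih => rw [pow_succ]; exact ih.mul hP

/-- The mean displacement of a stationary chain after `t` steps is at most `t` times the mean
displacement of one step. -/
theorem sum_pow_dist_le [DecidableEq ι] (hP : IsStationaryChain μ P) (d : ι → ι → ℝ)
    (h0 : ∀ i, d i i = 0)
    (htri : ∀ i l j, d i j ≤ d i l + d l j) (t : ℕ) :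
    ∑ i, ∑ j, μ i * (P ^ t) i j * d i j ≤ t * ∑ i, ∑ j, μ i * P i j * d i j := by
  induction t with
  | zero => simp [Matrix.one_apply, h0]
  | succ t ih =>
    have hPt := hP.pow t
    calc ∑ i, ∑ j, μ i * (P ^ (t + 1)) i j * d i j
        = ∑ i, ∑ j, ∑ l, μ i * (P ^ t) i l * P l j * d i j := by
          simp only [pow_succ, Matrix.mul_apply, Finset.mul_sum, Finset.sum_mul, mul_assoc]
      _ ≤ ∑ i, ∑ j, ∑ l,
            (μ i * (P ^ t) i l * P l j * d i l + μ i * (P ^ t) i l * P l j * d l j) := by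
          refine Finset.sum_le_sum fun i _ => Finset.sum_le_sum fun j _ =>
            Finset.sum_le_sum fun l _ => ?_
          rw [← mul_add]
          exact mul_le_mul_of_nonneg_left (htri i l j) (mul_nonneg (mul_nonneg
            (hP.weight_nonneg i) (hPt.nonneg i l)) (hP.nonneg l j))
      _ = (∑ i, ∑ l, μ i * (P ^ t) i l * d i l) + ∑ l, ∑ j, μ l * P l j * d l j := by
          simp only [Finset.sum_add_distrib]
          congr 1
          · refine Finset.sum_congr rfl fun i _ => ?_
            rw [Finset.sum_comm]
            refine Finset.sum_congr rfl fun l _ => ?_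
            simp only [mul_right_comm _ (P l _), ← Finset.mul_sum, hP.row_sum, mul_one]
          · have hl : ∀ l j, μ l * P l j * d l j =
                ∑ i, μ i * (P ^ t) i l * P l j * d l j := fun l j => by
              rw [← Finset.sum_mul, ← Finset.sum_mul, hPt.stationary]
            simp only [hl]
            rw [Finset.sum_comm, Finset.sum_comm (f := fun l j =>
              ∑ i, μ i * (P ^ t) i l * P l j * d l j)]
            exact Finset.sum_congr rfl fun j _ => Finset.sum_comm
      _ ≤ _ := by push_cast; linarith

theorem sum_mulVec (hP : IsStationaryChain μ P) (w : ι → ℝ) :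
    ∑ i, μ i * (P.mulVec w) i = ∑ i, μ i * w i := by
  simp only [Matrix.mulVec, dotProduct, Finset.mul_sum]
  rw [Finset.sum_comm]
  simp only [← mul_assoc, ← Finset.sum_mul, hP.stationary]

theorem sum_pow_mulVec_sq_le [DecidableEq ι] (hP : IsStationaryChain μ P) {q : ℝ} (hq : 0 ≤ q)
    (hgap : ∀ w : ι → ℝ, ∑ i, μ i * w i = 0 →
      ∑ i, μ i * (P.mulVec w) i ^ 2 ≤ q * ∑ i, μ i * w i ^ 2) (t : ℕ)
    (w : ι → ℝ) (hw : ∑ i, μ i * w i = 0) :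
    ∑ i, μ i * ((P ^ t).mulVec w) i ^ 2 ≤ q ^ t * ∑ i, μ i * w i ^ 2 := by
  induction t with
  | zero => simp
  | succ t ih =>
    rw [pow_succ', ← Matrix.mulVec_mulVec]
    refine (hgap _ ((hP.pow t).sum_mulVec w ▸ hw)).trans ?_
    rw [pow_succ', mul_assoc]
    exact mul_le_mul_of_nonneg_left ih hq

variable {X : Type*} [NormedAddCommGroup X] [NormedSpace ℝ X]

/-- A contraction estimate for mean-zero real functions passes to `X`-valued functions at the
cost of a factor `k ^ 2`, where `k` is the dimension. -/
theorem sum_pow_smul_norm_sq_le [DecidableEq ι] [FiniteDimensional ℝ X] (hP : IsStationaryChain μ P)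
    {q : ℝ} (hq : 0 ≤ q)
    (hgap : ∀ w : ι → ℝ, ∑ i, μ i * w i = 0 →
      ∑ i, μ i * (P.mulVec w) i ^ 2 ≤ q * ∑ i, μ i * w i ^ 2) (t : ℕ)
    (w : ι → X) (hw : ∑ i, μ i • w i = 0) :
    ∑ i, μ i * ‖∑ j, (P ^ t) i j • w j‖ ^ 2 ≤
      (Module.finrank ℝ X : ℝ) ^ 2 * q ^ t * ∑ i, μ i * ‖w i‖ ^ 2 := by
  set k := Module.finrank ℝ X with hk
  obtain ⟨l, hl1, hl2⟩ := exists_auerbach_functionals hk.symm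
  have hpt : ∀ z : X, ‖z‖ ^ 2 ≤ k * ∑ a, l a z ^ 2 := fun z => by
    calc ‖z‖ ^ 2 ≤ (∑ a, |l a z|) ^ 2 := pow_le_pow_left₀ (norm_nonneg _) (hl2 z) 2
      _ ≤ (Finset.univ : Finset (Fin k)).card * ∑ a, |l a z| ^ 2 := sq_sum_le_card_mul_sum_sq
      _ = k * ∑ a, l a z ^ 2 := by simp [sq_abs]
  calc ∑ i, μ i * ‖∑ j, (P ^ t) i j • w j‖ ^ 2
      ≤ ∑ i, μ i * (k * ∑ a, ((P ^ t).mulVec fun j => l a (w j)) i ^ 2) := by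
        refine Finset.sum_le_sum fun i _ => mul_le_mul_of_nonneg_left ?_ (hP.weight_nonneg i)
        refine (hpt _).trans (le_of_eq ?_)
        simp [Matrix.mulVec, dotProduct]
    _ = k * ∑ a, ∑ i, μ i * ((P ^ t).mulVec fun j => l a (w j)) i ^ 2 := by
        rw [Finset.sum_comm, Finset.mul_sum]
        refine Finset.sum_congr rfl fun i _ => ?_
        rw [← Finset.mul_sum]; ring
    _ ≤ k * ∑ a : Fin k, q ^ t * ∑ i, μ i * ‖w i‖ ^ 2 := by
        refine mul_le_mul_of_nonneg_left (Finset.sum_le_sum fun a _ => ?_) (Nat.cast_nonneg _)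
        refine (hP.sum_pow_mulVec_sq_le hq hgap t _ ?_).trans
          (mul_le_mul_of_nonneg_left (Finset.sum_le_sum fun i _ => ?_) (pow_nonneg hq t))
        · simpa using congrArg (l a) hw
        · refine mul_le_mul_of_nonneg_left ?_ (hP.weight_nonneg i)
          rw [← sq_abs]
          exact pow_le_pow_left₀ (abs_nonneg _) (hl1 a _) 2
    _ = _ := by simp; ring

theorem sum_norm_sq_le_of_contraction (hP : IsStationaryChain μ P) (w : ι → X)
    (hcontr : ∑ i, μ i * ‖∑ j, P i j • w j‖ ^ 2 ≤ 1 / 4 * ∑ i, μ i * ‖w i‖ ^ 2) :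
    ∑ i, μ i * ‖w i‖ ^ 2 ≤ 4 * ∑ i, ∑ j, μ i * P i j * ‖w i - w j‖ ^ 2 := by
  have hJ : ∀ i, ‖w i - ∑ j, P i j • w j‖ ^ 2 ≤ ∑ j, P i j * ‖w i - w j‖ ^ 2 := by
    intro i
    have h1 : w i - ∑ j, P i j • w j = ∑ j, P i j • (w i - w j) := by
      simp only [smul_sub, Finset.sum_sub_distrib, ← Finset.sum_smul, hP.row_sum, one_smul]
    have h2 : ‖w i - ∑ j, P i j • w j‖ ≤ ∑ j, P i j * ‖w i - w j‖ := by
      rw [h1]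
      refine (norm_sum_le _ _).trans (le_of_eq (Finset.sum_congr rfl fun j _ => ?_))
      rw [norm_smul, Real.norm_of_nonneg (hP.nonneg i j)]
    calc _ ≤ (∑ j, P i j * ‖w i - w j‖) ^ 2 := pow_le_pow_left₀ (norm_nonneg _) h2 2
      _ ≤ (∑ j, P i j) * ∑ j, P i j * ‖w i - w j‖ ^ 2 :=
        Finset.sum_sq_le_sum_mul_sum_of_sq_le_mul _ (fun j _ => hP.nonneg i j)
          (fun j _ => mul_nonneg (hP.nonneg i j) (sq_nonneg _)) fun j _ => le_of_eq (by ring)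
      _ = _ := by rw [hP.row_sum, one_mul]
  have hmain : ∑ i, μ i * ‖w i‖ ^ 2 ≤
      2 * ∑ i, ∑ j, μ i * P i j * ‖w i - w j‖ ^ 2 + 2 * ∑ i, μ i * ‖∑ j, P i j • w j‖ ^ 2 := by
    rw [Finset.mul_sum, Finset.mul_sum, ← Finset.sum_add_distrib]
    refine Finset.sum_le_sum fun i _ => ?_
    simp only [mul_assoc]
    rw [← Finset.mul_sum]
    have h3 : ‖w i‖ ≤ ‖w i - ∑ j, P i j • w j‖ + ‖∑ j, P i j • w j‖ := by
      simpa using norm_add_le (w i - ∑ j, P i j • w j) (∑ j, P i j • w j)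
    have h4 : ‖w i‖ ^ 2 ≤ 2 * ‖w i - ∑ j, P i j • w j‖ ^ 2 + 2 * ‖∑ j, P i j • w j‖ ^ 2 := by
      nlinarith [norm_nonneg (w i), sq_nonneg (‖w i - ∑ j, P i j • w j‖ - ‖∑ j, P i j • w j‖)]
    nlinarith [hJ i, hP.weight_nonneg i]
  linarith

/-- **Poincaré inequality in a `k`-dimensional space.** If `t` steps of the chain suffice for the
`L²` contraction to beat the dimensional factor `k ^ 2`, then the average distance between two
independent stationary points is `O(t)` times the average length of one step. -/
theorem sum_sum_norm_sub_le [DecidableEq ι] [FiniteDimensional ℝ X] (hP : IsStationaryChain μ P)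
    {q : ℝ} (hq : 0 ≤ q)
    (hgap : ∀ w : ι → ℝ, ∑ i, μ i * w i = 0 →
      ∑ i, μ i * (P.mulVec w) i ^ 2 ≤ q * ∑ i, μ i * w i ^ 2) (t : ℕ)
    (ht : (Module.finrank ℝ X : ℝ) ^ 2 * q ^ t ≤ 1 / 4) (x : ι → X) :
    ∑ i, ∑ j, μ i * μ j * ‖x i - x j‖ ≤ 384 * (t * ∑ i, ∑ j, μ i * P i j * ‖x i - x j‖) := by
  have hμ := hP.weight_nonneg
  have h1 := hP.sum_weight
  have hPt := hP.pow t
  set m : X := ∑ i, μ i • x i with hm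
  set y : ι → X := fun i => x i - m with hydef
  have hyx : ∀ i j, y i - y j = x i - x j := fun i j => by simp [hydef]
  have hy : ∑ i, μ i • y i = 0 := by
    simp only [hydef, smul_sub, Finset.sum_sub_distrib, ← Finset.sum_smul, h1, one_smul, ← hm,
      sub_self]
  set u : ι → X := fun i => mazurMap (y i) with hu
  set w : ι → X := fun i => u i - ∑ i, μ i • u i with hwdef
  have hwu : ∀ i j, w i - w j = u i - u j := fun i j => by simp [hwdef]
  have hw : ∑ i, μ i • w i = 0 := by
    simp only [hwdef, smul_sub, Finset.sum_sub_distrib, ← Finset.sum_smul, h1, one_smul, sub_self]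
  have hV0 : 0 ≤ ∑ i, μ i * ‖w i‖ ^ 2 :=
    Finset.sum_nonneg fun i _ => mul_nonneg (hμ i) (sq_nonneg _)
  have hA := hPt.sum_norm_sq_le_of_contraction w
    ((hP.sum_pow_smul_norm_sq_le hq hgap t w hw).trans (mul_le_mul_of_nonneg_right ht hV0))
  have hB : ∑ i, ∑ j, μ i * (P ^ t) i j * ‖w i - w j‖ ^ 2 ≤
      6 * ∑ i, ∑ j, μ i * (P ^ t) i j * ‖x i - x j‖ := by
    simp only [Finset.mul_sum]
    refine Finset.sum_le_sum fun i _ => Finset.sum_le_sum fun j _ => ?_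
    have h2 : ‖w i - w j‖ ^ 2 ≤ 6 * ‖x i - x j‖ := by
      rw [hwu, ← hyx]; exact norm_mazurMap_sub_sq_le _ _
    nlinarith [mul_nonneg (hμ i) (hPt.nonneg i j)]
  have hC := hP.sum_pow_dist_le (fun i j => ‖x i - x j‖) (fun i => by simp)
    (fun i l j => by simpa using norm_add_le (x i - x l) (x l - x j)) t
  have hD : ∑ i, ∑ j, μ i * μ j * ‖u i - u j‖ ^ 2 ≤ 4 * ∑ i, μ i * ‖w i‖ ^ 2 := by
    have e1 : ∑ i, ∑ j, μ i * μ j * (2 * ‖w i‖ ^ 2) = 2 * ∑ i, μ i * ‖w i‖ ^ 2 := by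
      rw [Finset.mul_sum]
      refine Finset.sum_congr rfl fun i _ => ?_
      rw [← Finset.sum_mul, ← Finset.mul_sum, h1]; ring
    have e2 : ∑ i, ∑ j, μ i * μ j * (2 * ‖w j‖ ^ 2) = 2 * ∑ i, μ i * ‖w i‖ ^ 2 := by
      rw [Finset.sum_comm, ← e1]
      exact Finset.sum_congr rfl fun i _ => Finset.sum_congr rfl fun j _ => by ring
    have e3 : 4 * ∑ i, μ i * ‖w i‖ ^ 2 =
        ∑ i, ∑ j, (μ i * μ j * (2 * ‖w i‖ ^ 2) + μ i * μ j * (2 * ‖w j‖ ^ 2)) := by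
      simp only [Finset.sum_add_distrib, e1, e2]; ring
    rw [e3]
    refine Finset.sum_le_sum fun i _ => Finset.sum_le_sum fun j _ => ?_
    rw [← hwu, ← mul_add]
    refine mul_le_mul_of_nonneg_left ?_ (mul_nonneg (hμ i) (hμ j))
    have := norm_sub_le (w i) (w j)
    nlinarith [norm_nonneg (w i - w j), sq_nonneg (‖w i‖ - ‖w j‖)]
  have hE := sum_sum_norm_sub_le_mazurMap hμ h1 y hy
  simp only [hyx] at hE
  linarith

end IsStationaryChain

/-! ### From a spectral gap to a Poincaré inequality -/

/-- **Nonlinear spectral gap of a `k`-dimensional space.** If the symmetric weights `b` satisfy a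
Poincaré inequality with constant `g` for real functions with squared differences, then they
satisfy one for `X`-valued functions with unsquared distances, with constant `g / O(log k)`.
The chain `1 - ε L`, with `L` the Laplacian of `b`, contracts mean-zero functions by `1 - ε g`
in `L²`, hence beats the factor `k ^ 2` after `t ≈ log (4 k ^ 2) / (ε g)` steps. -/
theorem mul_sum_sum_norm_sub_le_log {ι : Type*} [Fintype ι] {X : Type*} [NormedAddCommGroup X]
    [NormedSpace ℝ X] [FiniteDimensional ℝ X] (hk : 2 ≤ Module.finrank ℝ X)
    {μ : ι → ℝ} (hμ : ∀ i, 0 < μ i) (h1 : ∑ i, μ i = 1)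
    {b : ι → ι → ℝ} (hb : ∀ i j, 0 ≤ b i j) (hsymm : ∀ i j, b i j = b j i) {g : ℝ} (hg : 0 < g)
    (hgap : ∀ w : ι → ℝ, g * ∑ i, ∑ j, μ i * μ j * (w i - w j) ^ 2 ≤
      ∑ i, ∑ j, b i j * (w i - w j) ^ 2) (x : ι → X) :
    g * ∑ i, ∑ j, μ i * μ j * ‖x i - x j‖ ≤
      2304 * Real.log (Module.finrank ℝ X) * ∑ i, ∑ j, b i j * ‖x i - x j‖ := by
  classical
  set k := Module.finrank ℝ X with hkdef
  set β : ι → ℝ := fun i => ∑ j, b i j with hβ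
  have hβ0 : ∀ i, 0 ≤ β i := fun i => Finset.sum_nonneg fun j _ => hb i j
  obtain ⟨ε, hε, hεμ, hεg⟩ : ∃ ε : ℝ, 0 < ε ∧ (∀ i, 2 * ε * β i ≤ μ i) ∧ ε * g ≤ 1 := by
    have hs : ∀ i, 0 ≤ 2 * β i / μ i := fun i =>
      div_nonneg (mul_nonneg zero_le_two (hβ0 i)) (hμ i).le
    have hs' : 0 ≤ ∑ i, 2 * β i / μ i := Finset.sum_nonneg fun i _ => hs i
    have hpos : 0 < g + ∑ i, 2 * β i / μ i := by linarith
    refine ⟨(g + ∑ i, 2 * β i / μ i)⁻¹, inv_pos.2 hpos, fun i => ?_, ?_⟩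
    · have h2 : 2 * β i / μ i ≤ g + ∑ i, 2 * β i / μ i :=
        (Finset.single_le_sum (fun i _ => hs i) (Finset.mem_univ i)).trans (by linarith)
      rw [div_le_iff₀ (hμ i)] at h2
      rw [mul_comm 2, mul_assoc, inv_mul_le_iff₀ hpos]
      exact h2
    · rw [inv_mul_le_iff₀ hpos]; linarith
  let P : Matrix ι ι ℝ := fun i j => ε * b i j / μ i + if i = j then 1 - ε * β i / μ i else 0
  have hPμ : ∀ i j, μ i * P i j = ε * b i j + if i = j then μ i - ε * β i else 0 := by
    intro i j
    have := (hμ i).ne'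
    simp only [P]
    split_ifs
    · field_simp
    · simp only [add_zero]; field_simp
  have hP : IsStationaryChain μ P := by
    refine ⟨fun i => (hμ i).le, h1, fun i j => ?_, fun i => ?_, fun j => ?_⟩
    · refine add_nonneg (div_nonneg (mul_nonneg hε.le (hb i j)) (hμ i).le) ?_
      split_ifs
      · rw [sub_nonneg, div_le_one (hμ i)]
        nlinarith [hεμ i, mul_nonneg hε.le (hβ0 i)]
      · exact le_rfl
    · simp only [P, Finset.sum_add_distrib, Finset.sum_ite_eq, Finset.mem_univ, if_true]
      rw [← Finset.sum_div, ← Finset.mul_sum]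
      ring
    · simp only [hPμ, Finset.sum_add_distrib, Finset.sum_ite_eq', Finset.mem_univ, if_true]
      rw [← Finset.mul_sum, Finset.sum_congr rfl fun i _ => hsymm i j]
      ring
  have hPw : ∀ (w : ι → ℝ) i, (P.mulVec w) i = w i - ε / μ i * ∑ j, b i j * (w i - w j) := by
    intro w i
    have : ∑ j, b i j * (w i - w j) = β i * w i - ∑ j, b i j * w j := by
      simp only [mul_sub, Finset.sum_sub_distrib, ← Finset.sum_mul, hβ]
    rw [this]
    simp only [Matrix.mulVec, dotProduct, P, add_mul, Finset.sum_add_distrib, ite_mul, zero_mul,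
      Finset.sum_ite_eq, Finset.mem_univ, if_true]
    have h2 : ∑ j, ε * b i j / μ i * w j = ε / μ i * ∑ j, b i j * w j := by
      rw [Finset.mul_sum]; exact Finset.sum_congr rfl fun j _ => by ring
    rw [h2]; ring
  have hcontr : ∀ w : ι → ℝ, ∑ i, μ i * w i = 0 →
      ∑ i, μ i * (P.mulVec w) i ^ 2 ≤ (1 - ε * g) * ∑ i, μ i * w i ^ 2 := by
    intro w hw
    set E := ∑ i, ∑ j, b i j * (w i - w j) ^ 2 with hE
    set L : ι → ℝ := fun i => ∑ j, b i j * (w i - w j) with hL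
    have hwL : 2 * ∑ i, w i * L i = E := by
      have e1 : ∑ i, w i * L i = ∑ i, ∑ j, b i j * (w i * (w i - w j)) := by
        refine Finset.sum_congr rfl fun i _ => ?_
        rw [hL, Finset.mul_sum]; exact Finset.sum_congr rfl fun j _ => by ring
      have e2 : ∑ i, w i * L i = ∑ i, ∑ j, b i j * (w j * (w j - w i)) := by
        rw [e1, Finset.sum_comm]
        exact Finset.sum_congr rfl fun i _ => Finset.sum_congr rfl fun j _ => by rw [hsymm]
      rw [two_mul]
      nth_rewrite 1 [e1]
      rw [e2, ← Finset.sum_add_distrib]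
      refine Finset.sum_congr rfl fun i _ => ?_
      rw [← Finset.sum_add_distrib]
      exact Finset.sum_congr rfl fun j _ => by ring
    have hLsq : ∀ i, L i ^ 2 ≤ β i * ∑ j, b i j * (w i - w j) ^ 2 := fun i =>
      Finset.sum_sq_le_sum_mul_sum_of_sq_le_mul _ (fun j _ => hb i j)
        (fun j _ => mul_nonneg (hb i j) (sq_nonneg _)) fun j _ => le_of_eq (by ring)
    have hLE : ∑ i, ε ^ 2 / μ i * L i ^ 2 ≤ ε / 2 * E := by
      rw [hE, Finset.mul_sum]
      refine Finset.sum_le_sum fun i _ => ?_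
      have hnn : 0 ≤ ∑ j, b i j * (w i - w j) ^ 2 :=
        Finset.sum_nonneg fun j _ => mul_nonneg (hb i j) (sq_nonneg _)
      have e3 : ε ^ 2 / μ i * L i ^ 2 = ε * (ε * L i ^ 2) / μ i := by ring
      rw [e3, div_le_iff₀ (hμ i)]
      have h4 : ε * L i ^ 2 ≤ ε * (β i * ∑ j, b i j * (w i - w j) ^ 2) :=
        mul_le_mul_of_nonneg_left (hLsq i) hε.le
      have h5 := mul_le_mul_of_nonneg_right (hεμ i) hnn
      have h6 := mul_le_mul_of_nonneg_left (h4.trans (by linarith :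
        _ ≤ 1 / 2 * (μ i * ∑ j, b i j * (w i - w j) ^ 2))) hε.le
      linarith
    have hvar : ∑ i, ∑ j, μ i * μ j * (w i - w j) ^ 2 = 2 * ∑ i, μ i * w i ^ 2 := by
      have e4 : ∀ i, ∑ j, μ i * μ j * (w i - w j) ^ 2 =
          μ i * w i ^ 2 + μ i * ∑ j, μ j * w j ^ 2 := by
        intro i
        calc ∑ j, μ i * μ j * (w i - w j) ^ 2
            = ∑ j, (μ i * w i ^ 2 * μ j - 2 * μ i * w i * (μ j * w j)
                + μ i * (μ j * w j ^ 2)) := Finset.sum_congr rfl fun j _ => by ring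
          _ = _ := by
            rw [Finset.sum_add_distrib, Finset.sum_sub_distrib, ← Finset.mul_sum,
              ← Finset.mul_sum, ← Finset.mul_sum, h1, hw]; ring
      simp only [e4, Finset.sum_add_distrib, ← Finset.sum_mul, h1]; ring
    have hexp : ∑ i, μ i * (P.mulVec w) i ^ 2 =
        ∑ i, μ i * w i ^ 2 - ε * (2 * ∑ i, w i * L i) + ∑ i, ε ^ 2 / μ i * L i ^ 2 := by
      rw [Finset.mul_sum, Finset.mul_sum, ← Finset.sum_sub_distrib, ← Finset.sum_add_distrib]
      refine Finset.sum_congr rfl fun i _ => ?_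
      have := (hμ i).ne'
      rw [hPw]
      field_simp
      ring
    have hgw := hgap w
    rw [hvar] at hgw
    have := mul_le_mul_of_nonneg_left hgw hε.le
    rw [hexp, hwL]
    linarith
  have hk0 : (2 : ℝ) ≤ k := by exact_mod_cast hk
  set t : ℕ := ⌈Real.log (4 * (k : ℝ) ^ 2) / (ε * g)⌉₊ with ht
  have hεg0 : 0 < ε * g := mul_pos hε hg
  have hlog2 : 0.69 ≤ Real.log 2 := by linarith [Real.log_two_gt_d9]
  have hlogk : Real.log 2 ≤ Real.log k := Real.log_le_log (by norm_num) hk0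
  have hlog4k : Real.log (4 * (k : ℝ) ^ 2) = 2 * Real.log 2 + 2 * Real.log k := by
    rw [Real.log_mul (by norm_num) (by positivity), Real.log_pow,
      show (4 : ℝ) = 2 ^ 2 by norm_num, Real.log_pow]; norm_num
  have hpow : (k : ℝ) ^ 2 * (1 - ε * g) ^ t ≤ 1 / 4 := by
    have h2 : (1 - ε * g) ^ t ≤ Real.exp (-(ε * g)) ^ t :=
      pow_le_pow_left₀ (by linarith) (by linarith [Real.add_one_le_exp (-(ε * g))]) t
    have h3 : Real.exp (-(ε * g)) ^ t ≤ (4 * (k : ℝ) ^ 2)⁻¹ := by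
      rw [← Real.exp_nat_mul, ← Real.exp_log (show 0 < 4 * (k : ℝ) ^ 2 by positivity),
        ← Real.exp_neg]
      refine Real.exp_le_exp.2 ?_
      have h4 : Real.log (4 * (k : ℝ) ^ 2) / (ε * g) ≤ t := Nat.le_ceil _
      rw [div_le_iff₀ hεg0] at h4
      linarith
    calc (k : ℝ) ^ 2 * (1 - ε * g) ^ t ≤ (k : ℝ) ^ 2 * (4 * (k : ℝ) ^ 2)⁻¹ :=
          mul_le_mul_of_nonneg_left (h2.trans h3) (by positivity)
      _ = 1 / 4 := by field_simp
  have hmain := hP.sum_sum_norm_sub_le (by linarith) hcontr t hpow x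
  have hstep : ∑ i, ∑ j, μ i * P i j * ‖x i - x j‖ = ε * ∑ i, ∑ j, b i j * ‖x i - x j‖ := by
    simp only [Finset.mul_sum]
    refine Finset.sum_congr rfl fun i _ => Finset.sum_congr rfl fun j _ => ?_
    rw [hPμ]
    split_ifs with h
    · simp [h]
    · ring
  rw [hstep] at hmain
  have hB0 : 0 ≤ ∑ i, ∑ j, b i j * ‖x i - x j‖ :=
    Finset.sum_nonneg fun i _ => Finset.sum_nonneg fun j _ => mul_nonneg (hb i j) (norm_nonneg _)
  have htlt : t * (ε * g) ≤ 6 * Real.log k := by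
    have h5 : (t : ℝ) < Real.log (4 * (k : ℝ) ^ 2) / (ε * g) + 1 :=
      Nat.ceil_lt_add_one (div_nonneg (by rw [hlog4k]; linarith) hεg0.le)
    have h6 := mul_le_mul_of_nonneg_right h5.le hεg0.le
    rw [add_mul, div_mul_cancel₀ _ hεg0.ne', hlog4k] at h6
    linarith
  calc g * ∑ i, ∑ j, μ i * μ j * ‖x i - x j‖
      ≤ g * (384 * (t * (ε * ∑ i, ∑ j, b i j * ‖x i - x j‖))) :=
        mul_le_mul_of_nonneg_left hmain hg.le
    _ = 384 * (t * (ε * g)) * ∑ i, ∑ j, b i j * ‖x i - x j‖ := by ring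
    _ ≤ 2304 * Real.log k * ∑ i, ∑ j, b i j * ‖x i - x j‖ :=
        mul_le_mul_of_nonneg_right (by linarith) hB0

/-! ### Duality -/

/-- The squared distance `‖f i - f j‖²` between two points of a Hilbert space, expressed by the
Gram matrix `K` of `f`. -/
def kernelSqDist {I : Type*} (K : Matrix I I ℝ) (i j : I) : ℝ := K i i + K j j - 2 * K i j

theorem kernelSqDist_smul {I : Type*} (r : ℝ) (K : Matrix I I ℝ) (i j : I) :
    kernelSqDist (r • K) i j = r * kernelSqDist K i j := by
  simp [kernelSqDist]; ring

theorem kernelSqDist_add {I : Type*} (K L : Matrix I I ℝ) (i j : I) :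
    kernelSqDist (K + L) i j = kernelSqDist K i j + kernelSqDist L i j := by
  simp [kernelSqDist]; ring

theorem kernelSqDist_vecMulVec {I : Type*} (w : I → ℝ) (i j : I) :
    kernelSqDist (Matrix.vecMulVec w (star w)) i j = (w i - w j) ^ 2 := by
  simp [kernelSqDist, Matrix.vecMulVec_apply]; ring

/-- The spectral gap estimate, dualised: for every fully supported probability vector on a finite
set of points there is a Gram matrix with controlled distances that does not decrease the average
distance. If there were none, a hyperplane would separate the squared distance matrices of
Gram matrices from those that obey the control, and the coefficients of the hyperplane would be
weights that contradict `mul_sum_sum_norm_sub_le_log`. -/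
theorem exists_posSemidef_kernelSqDist_le_of_sum_eq_one {F : Type*} [Fintype F] {X : Type*}
    [NormedAddCommGroup X] [NormedSpace ℝ X] [FiniteDimensional ℝ X]
    (hk : 2 ≤ Module.finrank ℝ X) {x : F → X} (hx : Function.Injective x) {μ : F → ℝ}
    (hμ : ∀ i, 0 < μ i) (h1 : ∑ i, μ i = 1) {Δ : ℝ}
    (hΔ : 2304 * Real.log (Module.finrank ℝ X) < Δ) :
    ∃ K : Matrix F F ℝ, K.PosSemidef ∧ (∀ i j, kernelSqDist K i j ≤ Δ * ‖x i - x j‖) ∧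
      ∑ i, ∑ j, μ i * μ j * ‖x i - x j‖ ≤ ∑ i, ∑ j, μ i * μ j * kernelSqDist K i j := by
  classical
  set M := ∑ i, ∑ j, μ i * μ j * ‖x i - x j‖ with hM
  have hΔ0 : 0 < Δ := lt_of_le_of_lt (mul_nonneg (by norm_num)
    (Real.log_natCast_nonneg _)) hΔ
  have hM0 : 0 ≤ M := Finset.sum_nonneg fun i _ => Finset.sum_nonneg fun j _ =>
    mul_nonneg (mul_nonneg (hμ i).le (hμ j).le) (norm_nonneg _)
  rcases hM0.eq_or_lt with hM0 | hM0
  · refine ⟨0, Matrix.PosSemidef.zero, fun i j => ?_, ?_⟩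
    · simpa [kernelSqDist] using mul_nonneg hΔ0.le (norm_nonneg (x i - x j))
    · simp [kernelSqDist, ← hM0]
  -- adding `1` on the diagonal makes all constraints strict without affecting their content
  set c : F × F → ℝ := fun p => Δ * ‖x p.1 - x p.2‖ + if p.1 = p.2 then 1 else 0 with hc
  have hc0 : ∀ p, 0 < c p := by
    intro p
    by_cases h : p.1 = p.2
    · simp [hc, h]
    · simp only [hc, h, if_false, add_zero]
      exact mul_pos hΔ0 (norm_pos_iff.2 (sub_ne_zero.2 (hx.ne h)))
  set O : Set (F × F → ℝ) := Set.univ.pi fun _ => Set.Iio 0 with hO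
  set T : Set (F × F → ℝ) := {v | ∃ K : Matrix F F ℝ, K.PosSemidef ∧
    ∑ i, ∑ j, μ i * μ j * kernelSqDist K i j = M ∧
    ∀ p, v p = kernelSqDist K p.1 p.2 - c p} with hT
  by_cases hdisj : Disjoint O T
  swap
  · obtain ⟨v, hvO, K, hK, hKM, hv⟩ := Set.not_disjoint_iff.1 hdisj
    refine ⟨K, hK, fun i j => ?_, hKM.ge⟩
    have h2 : v (i, j) < 0 := hvO (i, j) (Set.mem_univ _)
    rw [hv] at h2
    by_cases h : i = j
    · subst h; simp [kernelSqDist, two_mul]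
    · simp only [hc, h, if_false, add_zero] at h2
      linarith
  exfalso
  have hOopen : IsOpen O := isOpen_set_pi Set.finite_univ fun _ _ => isOpen_Iio
  have hOconv : Convex ℝ O := convex_pi fun _ _ => convex_Iio 0
  have hTconv : Convex ℝ T := by
    rintro v ⟨K, hK, hKM, hv⟩ w ⟨L, hL, hLM, hw⟩ r s hr hs hrs
    refine ⟨r • K + s • L, (hK.smul hr).add (hL.smul hs), ?_, fun p => ?_⟩
    · simp only [kernelSqDist_add, kernelSqDist_smul, mul_add, Finset.sum_add_distrib,
        mul_left_comm _ r, mul_left_comm _ s, ← Finset.mul_sum, hKM, hLM]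
      rw [← add_mul, hrs, one_mul]
    · simp only [kernelSqDist_add, kernelSqDist_smul, Pi.add_apply, Pi.smul_apply, smul_eq_mul,
        hv, hw]
      linear_combination (-c p) * hrs
  obtain ⟨f, s, hfO, hfT⟩ := geometric_hahn_banach_open hOconv hOopen hTconv hdisj
  set a : F × F → ℝ := fun p => f (Pi.single p 1) with ha
  have hf : ∀ v, f v = ∑ p, a p * v p := by
    intro v
    conv_lhs => rw [pi_eq_sum_univ' v]
    rw [map_sum]
    refine Finset.sum_congr rfl fun p _ => ?_
    rw [map_smul, smul_eq_mul, mul_comm]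
  have hs0 : 0 ≤ s := by
    have h2 : ∀ δ : ℝ, 0 < δ → -δ * ∑ p, a p < s := by
      intro δ hδ
      have := hfO (fun _ => -δ) fun p _ => by simpa using hδ
      rw [hf] at this
      rwa [← Finset.sum_mul, mul_comm] at this
    have h3 : Filter.Tendsto (fun δ : ℝ => -δ * ∑ p, a p) (nhdsWithin 0 (Set.Ioi 0))
        (nhds (-0 * ∑ p, a p)) :=
      ((by fun_prop : Continuous fun δ : ℝ => -δ * ∑ p, a p).tendsto 0).mono_left
        nhdsWithin_le_nhds
    have := le_of_tendsto h3 (Filter.eventually_of_mem self_mem_nhdsWithin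
      fun δ hδ => (h2 δ hδ).le)
    simpa using this
  have ha0 : ∀ p, 0 ≤ a p := by
    intro p
    by_contra hneg
    push Not at hneg
    set A := ∑ q, a q with hA
    have h2 : ∀ n : ℝ, 0 ≤ n → -A - n * a p < s := by
      intro n hn
      have h3 := hfO (fun q => -1 - n * (Pi.single p 1 : F × F → ℝ) q) fun q _ => by
        have : 0 ≤ (Pi.single p 1 : F × F → ℝ) q := by
          by_cases h : q = p
          · subst h; simp
          · simp [h]
        simp only [Set.mem_Iio]
        nlinarith
      rw [hf] at h3
      have h4 : ∑ q, a q * (-1 - n * (Pi.single p 1 : F × F → ℝ) q) = -A - n * a p := by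
        simp only [mul_sub, Finset.sum_sub_distrib, mul_neg, mul_one, Finset.sum_neg_distrib, hA]
        congr 1
        rw [Finset.sum_eq_single p] <;> simp +contextual [mul_comm]
      linarith
    have h5 := h2 ((|s + A|) / -a p) (div_nonneg (abs_nonneg _) (by linarith))
    have h6 : |s + A| / -a p * a p = -|s + A| := by
      rw [div_neg, neg_mul, div_mul_cancel₀ _ hneg.ne]
    rw [h6] at h5
    linarith [le_abs_self (s + A)]
  set W := ∑ p, a p * c p with hW
  have hrank : ∀ w : F → ℝ, 0 < ∑ i, ∑ j, μ i * μ j * (w i - w j) ^ 2 →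
      W * ∑ i, ∑ j, μ i * μ j * (w i - w j) ^ 2 ≤ M * ∑ p : F × F, a p * (w p.1 - w p.2) ^ 2 ∧
      T.Nonempty := by
    intro w hw
    set S := ∑ i, ∑ j, μ i * μ j * (w i - w j) ^ 2 with hS
    have hmem : (fun p : F × F => M / S * (w p.1 - w p.2) ^ 2 - c p) ∈ T := by
      refine ⟨(M / S) • Matrix.vecMulVec w (star w),
        (Matrix.posSemidef_vecMulVec_self_star w).smul (div_nonneg hM0.le hw.le), ?_, fun p => ?_⟩
      · simp only [kernelSqDist_smul, kernelSqDist_vecMulVec, mul_left_comm _ (M / S),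
          ← Finset.mul_sum, ← hS]
        exact div_mul_cancel₀ _ hw.ne'
      · rw [kernelSqDist_smul, kernelSqDist_vecMulVec]
    refine ⟨?_, _, hmem⟩
    have h2 := hs0.trans (hfT _ hmem)
    rw [hf] at h2
    simp only [mul_sub, Finset.sum_sub_distrib, mul_left_comm _ (M / S), ← Finset.mul_sum,
      ← hW] at h2
    rw [sub_nonneg, div_mul_eq_mul_div, le_div_iff₀ hw] at h2
    exact h2
  have hTne : T.Nonempty := by
    obtain ⟨i, j, hij⟩ : ∃ i j : F, i ≠ j := by
      by_contra hcon
      push Not at hcon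
      refine hM0.ne' (Finset.sum_eq_zero fun i _ => Finset.sum_eq_zero fun j _ => ?_)
      simp [hcon i j]
    refine (hrank (Pi.single i 1) ?_).2
    have hnn : ∀ i' j', 0 ≤ μ i' * μ j' *
        ((Pi.single i 1 : F → ℝ) i' - (Pi.single i 1 : F → ℝ) j') ^ 2 :=
      fun i' j' => mul_nonneg (mul_nonneg (hμ _).le (hμ _).le) (sq_nonneg _)
    refine Finset.sum_pos' (fun i' _ => Finset.sum_nonneg fun j' _ => hnn i' j')
      ⟨i, Finset.mem_univ _, Finset.sum_pos' (fun j' _ => hnn i j') ⟨j, Finset.mem_univ _, ?_⟩⟩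
    simpa [hij.symm] using mul_pos (hμ i) (hμ j)
  have hW0 : 0 < W := by
    have hnn : ∀ p ∈ Finset.univ, 0 ≤ a p * c p := fun p _ => mul_nonneg (ha0 p) (hc0 p).le
    refine (Finset.sum_nonneg hnn).lt_of_ne fun h0 => ?_
    have ha' : ∀ p, a p = 0 := fun p => by
      have := (Finset.sum_eq_zero_iff_of_nonneg hnn).1 h0.symm p (Finset.mem_univ p)
      exact (mul_eq_zero.1 this).resolve_right (hc0 p).ne'
    obtain ⟨v, hv⟩ := hTne
    have h2 := hfT v hv
    have h3 := hfO (fun _ => -1) fun p _ => by simp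
    rw [hf] at h2 h3
    simp only [ha', zero_mul, Finset.sum_const_zero] at h2 h3
    linarith
  set b : F → F → ℝ := fun i j => (a (i, j) + a (j, i)) / 2 with hb
  have hbsum : ∀ d : F → F → ℝ, (∀ i j, d i j = d j i) →
      ∑ i, ∑ j, b i j * d i j = ∑ p : F × F, a p * d p.1 p.2 := by
    intro d hd
    rw [Fintype.sum_prod_type]
    have h2 : ∑ i, ∑ j, a (j, i) * d i j = ∑ i, ∑ j, a (i, j) * d i j := by
      rw [Finset.sum_comm]
      exact Finset.sum_congr rfl fun i _ => Finset.sum_congr rfl fun j _ => by rw [hd]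
    calc ∑ i, ∑ j, b i j * d i j
        = ∑ i, ∑ j, (1 / 2 * (a (i, j) * d i j) + 1 / 2 * (a (j, i) * d i j)) :=
          Finset.sum_congr rfl fun i _ => Finset.sum_congr rfl fun j _ => by
            simp only [hb]; ring
      _ = _ := by
          simp only [Finset.sum_add_distrib, ← Finset.mul_sum, h2]; ring
  have hfinal := mul_sum_sum_norm_sub_le_log hk hμ h1 (b := b)
    (fun i j => div_nonneg (add_nonneg (ha0 _) (ha0 _)) zero_le_two)
    (fun i j => by simp only [hb, add_comm]) (g := W / M) (div_pos hW0 hM0) (fun w => by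
      rw [hbsum (fun i j => (w i - w j) ^ 2) fun i j => by ring]
      have hnn : 0 ≤ ∑ i, ∑ j, μ i * μ j * (w i - w j) ^ 2 :=
        Finset.sum_nonneg fun i _ => Finset.sum_nonneg fun j _ =>
          mul_nonneg (mul_nonneg (hμ _).le (hμ _).le) (sq_nonneg _)
      rcases hnn.eq_or_lt with h0 | h0
      · rw [← h0, mul_zero]
        exact Finset.sum_nonneg fun p _ => mul_nonneg (ha0 p) (sq_nonneg _)
      · rw [div_mul_eq_mul_div, div_le_iff₀ hM0, mul_comm _ M]
        exact (hrank w h0).1) x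
  rw [hbsum (fun i j => ‖x i - x j‖) fun i j => norm_sub_rev _ _, ← hM,
    div_mul_cancel₀ _ hM0.ne'] at hfinal
  set Y := ∑ p : F × F, a p * ‖x p.1 - x p.2‖ with hY
  have hY0 : 0 ≤ Y := Finset.sum_nonneg fun p _ => mul_nonneg (ha0 p) (norm_nonneg _)
  have hWY : Δ * Y ≤ W := by
    rw [hY, hW, Finset.mul_sum]
    refine Finset.sum_le_sum fun p _ => ?_
    rw [mul_left_comm]
    refine mul_le_mul_of_nonneg_left ?_ (ha0 p)
    simp only [hc]
    split_ifs <;> linarith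
  rcases hY0.eq_or_lt with h0 | h0
  · rw [← h0, mul_zero] at hfinal
    linarith
  · have := mul_lt_mul_of_pos_right hΔ h0
    linarith

theorem exists_posSemidef_kernelSqDist_le {F : Type*} [Fintype F] {X : Type*}
    [NormedAddCommGroup X] [NormedSpace ℝ X] [FiniteDimensional ℝ X]
    (hk : 2 ≤ Module.finrank ℝ X) {x : F → X} (hx : Function.Injective x) {μ : F → ℝ}
    (hμ : ∀ i, 0 < μ i) {Δ : ℝ} (hΔ : 2304 * Real.log (Module.finrank ℝ X) < Δ) :
    ∃ K : Matrix F F ℝ, K.PosSemidef ∧ (∀ i j, kernelSqDist K i j ≤ Δ * ‖x i - x j‖) ∧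
      ∑ i, ∑ j, μ i * μ j * ‖x i - x j‖ ≤ ∑ i, ∑ j, μ i * μ j * kernelSqDist K i j := by
  rcases isEmpty_or_nonempty F with hF | hF
  · exact ⟨0, Matrix.PosSemidef.zero, fun i => isEmptyElim i, by simp⟩
  set m := ∑ i, μ i with hm
  have hm0 : 0 < m := Finset.sum_pos (fun i _ => hμ i) Finset.univ_nonempty
  obtain ⟨K, hK, hKd, hKs⟩ := exists_posSemidef_kernelSqDist_le_of_sum_eq_one hk hx
    (μ := fun i => μ i / m) (fun i => div_pos (hμ i) hm0)
    (by rw [← Finset.sum_div, ← hm, div_self hm0.ne']) hΔ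
  refine ⟨K, hK, hKd, ?_⟩
  have hscale : ∀ d : F → F → ℝ, ∑ i, ∑ j, μ i / m * (μ j / m) * d i j =
      (m ^ 2)⁻¹ * ∑ i, ∑ j, μ i * μ j * d i j := by
    intro d
    simp only [Finset.mul_sum]
    exact Finset.sum_congr rfl fun i _ => Finset.sum_congr rfl fun j _ => by
      field_simp
  rw [hscale, hscale] at hKs
  exact le_of_mul_le_mul_left hKs (by positivity)

/-! ### Positive semidefinite kernels and Hilbert spaces -/

/-- A real kernel, with its entries regarded as operators on the line. -/
noncomputable def kernelOp {I : Type*} (K : Matrix I I ℝ) : Matrix I I (ℝ →L[ℝ] ℝ) :=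
  K.map fun a => a • (1 : ℝ →L[ℝ] ℝ)

theorem posSemidef_kernelOp {I : Type*} {K : Matrix I I ℝ} (hK : K.PosSemidef) :
    (kernelOp K).PosSemidef := by
  have htfae := RKHS.posSemidef_tfae (𝕜 := ℝ) (K := kernelOp K)
  have hiff := htfae.out 0 2
  refine hiff.2 ⟨?_, fun w => ?_⟩
  · ext i j
    have h := hK.1.apply i j
    simp only [star_trivial] at h
    simp [kernelOp, h]
  · have h := hK.2 w
    rw [Finsupp.sum_comm] at h
    simpa [kernelOp, mul_comm, mul_left_comm, mul_assoc] using h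

/-- The canonical map from the index set of a positive semidefinite kernel to the Hilbert space that
the kernel reproduces. -/
noncomputable def kernelFeature {I : Type*} (K : Matrix I I ℝ) [Fact (kernelOp K).PosSemidef]
    (i : I) : RKHS.OfKernel (kernelOp K) :=
  RKHS.kerFun (RKHS.OfKernel (kernelOp K)) i 1

theorem inner_kernelFeature {I : Type*} (K : Matrix I I ℝ) [Fact (kernelOp K).PosSemidef]
    (i j : I) : inner ℝ (kernelFeature K i) (kernelFeature K j) = K j i := by
  rw [kernelFeature, kernelFeature, ← RKHS.kernel_inner, RKHS.OfKernel.kernel_ofKernel]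
  simp [kernelOp]

theorem norm_kernelFeature_sub_sq {I : Type*} (K : Matrix I I ℝ)
    [Fact (kernelOp K).PosSemidef] (i j : I) :
    ‖kernelFeature K i - kernelFeature K j‖ ^ 2 = kernelSqDist K i j := by
  rw [norm_sub_sq_real, ← real_inner_self_eq_norm_sq, ← real_inner_self_eq_norm_sq]
  simp only [inner_kernelFeature, kernelSqDist]
  have h : inner ℝ (kernelFeature K i) (kernelFeature K j) =
    inner ℝ (kernelFeature K j) (kernelFeature K i) := real_inner_comm _ _
  simp only [inner_kernelFeature] at h
  rw [h]; ring

theorem abs_le_of_posSemidef {I : Type*} {K : Matrix I I ℝ} (hK : K.PosSemidef) (i j : I) :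
    |K i j| ≤ (K i i + K j j) / 2 := by
  have : Fact (kernelOp K).PosSemidef := ⟨posSemidef_kernelOp hK⟩
  have h1 := norm_add_sq_real (kernelFeature K j) (kernelFeature K i)
  have h2 := norm_sub_sq_real (kernelFeature K j) (kernelFeature K i)
  rw [← real_inner_self_eq_norm_sq (kernelFeature K i),
    ← real_inner_self_eq_norm_sq (kernelFeature K j)] at h1 h2
  simp only [inner_kernelFeature] at h1 h2
  rw [abs_le]
  constructor <;> nlinarith [sq_nonneg ‖kernelFeature K j + kernelFeature K i‖,
    sq_nonneg ‖kernelFeature K j - kernelFeature K i‖]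

/-- A Gram matrix is positive semidefinite, also over an infinite index set. -/
theorem posSemidef_gram_of_infinite {I E : Type*} [NormedAddCommGroup E] [InnerProductSpace ℝ E]
    (f : I → E) : (Matrix.gram ℝ f).PosSemidef := by
  refine ⟨Matrix.isHermitian_gram ℝ f, fun w => ?_⟩
  have h : (w.sum fun i a => w.sum fun j b => star a * Matrix.gram ℝ f i j * b) =
      inner ℝ (w.sum fun i a => a • f i) (w.sum fun i a => a • f i) := by
    simp only [Finsupp.sum, sum_inner, inner_sum, real_inner_smul_left, real_inner_smul_right,
      Matrix.gram_apply, star_trivial]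
    exact Finset.sum_congr rfl fun i _ => Finset.sum_congr rfl fun j _ => by
      rw [real_inner_comm]; ring
  rw [h]
  exact real_inner_self_nonneg

/-- A kernel on a finite subset extends to the whole index set by collapsing the complement to a
base point `o` of the subset, and can be recentered so that `o` goes to the origin. -/
theorem exists_posSemidef_extension {I : Type*} {F : Finset I} {o : I} (ho : o ∈ F)
    {K : Matrix F F ℝ} (hK : K.PosSemidef) :
    ∃ L : Matrix I I ℝ, L.PosSemidef ∧ (∀ i : F, L i i = kernelSqDist K i ⟨o, ho⟩) ∧
      (∀ i ∉ F, L i i = 0) ∧ ∀ i j : F, kernelSqDist L i j = kernelSqDist K i j := by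
  classical
  have : Fact (kernelOp K).PosSemidef := ⟨posSemidef_kernelOp hK⟩
  let v : I → RKHS.OfKernel (kernelOp K) := fun i =>
    if h : i ∈ F then kernelFeature K ⟨i, h⟩ - kernelFeature K ⟨o, ho⟩ else 0
  have hv : ∀ i : F, v i = kernelFeature K i - kernelFeature K ⟨o, ho⟩ := fun i => by
    simp [v]
  refine ⟨Matrix.gram ℝ v, posSemidef_gram_of_infinite v, fun i => ?_, fun i hi => ?_,
    fun i j => ?_⟩
  · rw [Matrix.gram_apply, hv, real_inner_self_eq_norm_sq, norm_kernelFeature_sub_sq]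
  · simp [Matrix.gram_apply, v, hi]
  · rw [← norm_kernelFeature_sub_sq K]
    have : kernelFeature K i - kernelFeature K j = v i - v j := by rw [hv, hv]; abel
    rw [this, norm_sub_sq_real, kernelSqDist]
    simp only [Matrix.gram_apply, real_inner_self_eq_norm_sq]
    ring

instance {I : Type*} (K : {K : Matrix I I ℝ // Fact (kernelOp K).PosSemidef}) :
    Fact (kernelOp K.1).PosSemidef := K.2

/-- The Hilbert sum of the reproducing kernel Hilbert spaces of all positive semidefinite kernels
on `I`. Every Gram matrix indexed by `I` is realised in this one space, and the space lives in
the universe of `I`. -/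
abbrev KernelSum (I : Type*) : Type _ :=
  lp (fun K : {K : Matrix I I ℝ // Fact (kernelOp K).PosSemidef} =>
    RKHS.OfKernel (kernelOp K.1)) 2

theorem norm_lp_single_sub {α : Type*} {E : α → Type*} [∀ a, NormedAddCommGroup (E a)]
    [DecidableEq α] (a : α) (x y : E a) :
    ‖(lp.single 2 a x : lp E 2) - lp.single 2 a y‖ = ‖x - y‖ := by
  have h : (lp.single 2 a x : lp E 2) - lp.single 2 a y = lp.single 2 a (x - y) :=
    (map_sub (lp.singleAddMonoidHom 2 a) x y).symm
  rw [h, lp.norm_single (by norm_num)]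

theorem exists_kernelSum_norm_sub_sq {I : Type*} {K : Matrix I I ℝ} (hK : K.PosSemidef) :
    ∃ f : I → KernelSum I, ∀ i j, ‖f i - f j‖ ^ 2 = kernelSqDist K i j := by
  classical
  obtain ⟨K', rfl⟩ : ∃ K' : {K : Matrix I I ℝ // Fact (kernelOp K).PosSemidef}, K'.1 = K :=
    ⟨⟨K, ⟨posSemidef_kernelOp hK⟩⟩, rfl⟩
  refine ⟨fun i => lp.single 2 K' (kernelFeature K'.1 i), fun i j => ?_⟩
  rw [norm_lp_single_sub]
  exact norm_kernelFeature_sub_sq K'.1 i j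

/-! ### Finitely supported weights on an infinite index set -/

/-- A pointwise limit along a filter of positive semidefinite kernels is positive semidefinite. -/
theorem posSemidef_of_tendsto {I α : Type*} {l : Filter α} [l.NeBot] {L : α → Matrix I I ℝ}
    {K : Matrix I I ℝ} (hL : ∀ a, (L a).PosSemidef)
    (hK : ∀ i j, Filter.Tendsto (fun a => L a i j) l (nhds (K i j))) : K.PosSemidef := by
  refine ⟨?_, fun w => ?_⟩
  · ext i j
    refine tendsto_nhds_unique (hK j i) ?_
    refine (hK i j).congr fun a => ?_
    simpa using ((hL a).1.apply i j).symm
  · refine ge_of_tendsto' (x := l) ?_ fun a => (hL a).2 w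
    simp only [Finsupp.sum]
    exact tendsto_finsetSum _ fun i _ => tendsto_finsetSum _ fun j _ =>
      ((hK i j).const_mul _).mul_const _

/-- The kernel that works for a finite set of points `F` which contains the support of the weights.
Points of weight zero are given a small mass `δ`, at the cost of a factor two. -/
theorem exists_posSemidef_kernelSqDist_le_on_finset {I : Type*} {X : Type*}
    [NormedAddCommGroup X] [NormedSpace ℝ X] [FiniteDimensional ℝ X]
    (hk : 2 ≤ Module.finrank ℝ X) {x : I → X} (hx : Function.Injective x) {Δ : ℝ}
    (hΔ : 2304 * Real.log (Module.finrank ℝ X) < Δ) {F : Finset I} {w : I → ℝ}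
    (hw0 : ∀ i, 0 ≤ w i) (hw1 : ∀ i, w i ≤ 1) {o : I} (ho : o ∈ F)
    (hM : 0 < ∑ i ∈ F, ∑ j ∈ F, w i * w j * ‖x i - x j‖) :
    ∃ L : Matrix I I ℝ, L.PosSemidef ∧ (∀ i, L i i ≤ Δ * ‖x i - x o‖) ∧
      (∀ i ∈ F, ∀ j ∈ F, kernelSqDist L i j ≤ Δ * ‖x i - x j‖) ∧
      1 / 2 * ∑ i ∈ F, ∑ j ∈ F, w i * w j * ‖x i - x j‖ ≤
        ∑ i ∈ F, ∑ j ∈ F, w i * w j * kernelSqDist L i j := by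
  have hΔ0 : 0 < Δ := lt_of_le_of_lt (mul_nonneg (by norm_num)
    (Real.log_natCast_nonneg _)) hΔ
  set M := ∑ i ∈ F, ∑ j ∈ F, w i * w j * ‖x i - x j‖ with hMdef
  set R := ∑ i ∈ F, ∑ j ∈ F, ‖x i - x j‖ with hR
  have hR0 : 0 ≤ R := Finset.sum_nonneg fun i _ => Finset.sum_nonneg fun j _ => norm_nonneg _
  obtain ⟨δ, hδ0, hδ1, hδR⟩ : ∃ δ : ℝ, 0 < δ ∧ δ ≤ 1 ∧ 3 * δ * (Δ * R) ≤ M / 2 := by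
    have hpos : 0 < 6 * (Δ * R) + M := by positivity
    refine ⟨M / (6 * (Δ * R) + M), div_pos hM hpos, ?_, ?_⟩
    · rw [div_le_one hpos]; nlinarith [mul_nonneg hΔ0.le hR0]
    · rw [mul_div_assoc', div_mul_eq_mul_div, div_le_iff₀ hpos]
      nlinarith [mul_nonneg hΔ0.le hR0]
  obtain ⟨K, hK, hKd, hKs⟩ := exists_posSemidef_kernelSqDist_le hk (x := fun i : F => x i)
    (fun i j h => Subtype.ext (hx h)) (μ := fun i : F => w i + δ)
    (fun i => by linarith [hw0 i]) hΔ
  obtain ⟨L, hL, hLo, hL0, hLd⟩ := exists_posSemidef_extension ho hK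
  have hLF : ∀ i ∈ F, ∀ j ∈ F, kernelSqDist L i j ≤ Δ * ‖x i - x j‖ := fun i hi j hj => by
    have := hKd ⟨i, hi⟩ ⟨j, hj⟩
    rw [← hLd] at this
    exact this
  refine ⟨L, hL, fun i => ?_, hLF, ?_⟩
  · by_cases hi : i ∈ F
    · exact (hLo ⟨i, hi⟩).le.trans (hKd _ _)
    · rw [hL0 i hi]; positivity
  simp only [← hLd] at hKs
  have hconv : ∀ d : I → I → ℝ, ∑ i : F, ∑ j : F, (w i + δ) * (w j + δ) * d i j =
      ∑ i ∈ F, ∑ j ∈ F, (w i + δ) * (w j + δ) * d i j := fun d => by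
    rw [← Finset.sum_coe_sort F]
    exact Finset.sum_congr rfl fun i _ =>
      (Finset.sum_coe_sort F fun j => (w i + δ) * (w j + δ) * d i j)
  rw [hconv fun i j => ‖x i - x j‖, hconv fun i j => kernelSqDist L i j] at hKs
  have hlow : M ≤ ∑ i ∈ F, ∑ j ∈ F, (w i + δ) * (w j + δ) * ‖x i - x j‖ := by
    refine Finset.sum_le_sum fun i _ => Finset.sum_le_sum fun j _ =>
      mul_le_mul_of_nonneg_right ?_ (norm_nonneg _)
    nlinarith [hw0 i, hw0 j, mul_nonneg hδ0.le (hw0 i), mul_nonneg hδ0.le (hw0 j)]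
  have hup : ∑ i ∈ F, ∑ j ∈ F, (w i + δ) * (w j + δ) * kernelSqDist L i j ≤
      ∑ i ∈ F, ∑ j ∈ F, w i * w j * kernelSqDist L i j + 3 * δ * (Δ * R) := by
    have e : 3 * δ * (Δ * R) = ∑ i ∈ F, ∑ j ∈ F, 3 * δ * (Δ * ‖x i - x j‖) := by
      simp only [hR, Finset.mul_sum]
    rw [e, ← Finset.sum_add_distrib]
    refine Finset.sum_le_sum fun i hi => ?_
    rw [← Finset.sum_add_distrib]
    refine Finset.sum_le_sum fun j hj => ?_
    have h1 : 0 ≤ δ * w i + δ * w j + δ ^ 2 := by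
      have := mul_nonneg hδ0.le (hw0 i)
      have := mul_nonneg hδ0.le (hw0 j)
      positivity
    have h2 : δ * w i + δ * w j + δ ^ 2 ≤ 3 * δ := by
      nlinarith [mul_le_mul_of_nonneg_left (hw1 i) hδ0.le,
        mul_le_mul_of_nonneg_left (hw1 j) hδ0.le]
    have h3 := mul_le_mul_of_nonneg_left (hLF i hi j hj) h1
    have h4 := mul_le_mul_of_nonneg_right h2 (mul_nonneg hΔ0.le (norm_nonneg (x i - x j)))
    linarith
  linarith

/-- For finitely supported weights on an arbitrary family of distinct points there is a kernel that
controls the distances of the whole family. It is a limit, along an ultrafilter, of kernels for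
the finite subfamilies. -/
theorem exists_posSemidef_kernelSqDist_le_of_finset {I : Type*} {X : Type*}
    [NormedAddCommGroup X] [NormedSpace ℝ X] [FiniteDimensional ℝ X]
    (hk : 2 ≤ Module.finrank ℝ X) {x : I → X} (hx : Function.Injective x) {Δ : ℝ}
    (hΔ : 2304 * Real.log (Module.finrank ℝ X) < Δ) (S : Finset I) {w : I → ℝ}
    (hw0 : ∀ i, 0 ≤ w i) (hw1 : ∀ i, w i ≤ 1) (hwS : ∀ i ∉ S, w i = 0) :
    ∃ K : Matrix I I ℝ, K.PosSemidef ∧ (∀ i j, kernelSqDist K i j ≤ Δ * ‖x i - x j‖) ∧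
      1 / 2 * ∑ i ∈ S, ∑ j ∈ S, w i * w j * ‖x i - x j‖ ≤
        ∑ i ∈ S, ∑ j ∈ S, w i * w j * kernelSqDist K i j := by
  classical
  have hΔ0 : 0 < Δ := lt_of_le_of_lt (mul_nonneg (by norm_num)
    (Real.log_natCast_nonneg _)) hΔ
  set M := ∑ i ∈ S, ∑ j ∈ S, w i * w j * ‖x i - x j‖ with hM
  have hM0 : 0 ≤ M := Finset.sum_nonneg fun i _ => Finset.sum_nonneg fun j _ =>
    mul_nonneg (mul_nonneg (hw0 i) (hw0 j)) (norm_nonneg _)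
  rcases hM0.eq_or_lt with hM0 | hM0
  · refine ⟨0, Matrix.PosSemidef.zero, fun i j => ?_, ?_⟩
    · simpa [kernelSqDist] using mul_nonneg hΔ0.le (norm_nonneg (x i - x j))
    · simp [kernelSqDist, ← hM0]
  obtain ⟨o, ho⟩ : S.Nonempty := by
    rw [Finset.nonempty_iff_ne_empty]
    rintro rfl
    simp [hM] at hM0
  have hsub : ∀ (F : Finset I) (d : I → I → ℝ), ∑ i ∈ F ∪ S, ∑ j ∈ F ∪ S, w i * w j * d i j =
      ∑ i ∈ S, ∑ j ∈ S, w i * w j * d i j := by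
    intro F d
    symm
    calc ∑ i ∈ S, ∑ j ∈ S, w i * w j * d i j
        = ∑ i ∈ F ∪ S, ∑ j ∈ S, w i * w j * d i j :=
          Finset.sum_subset Finset.subset_union_right fun i _ hi => by simp [hwS i hi]
      _ = _ := Finset.sum_congr rfl fun i _ =>
          Finset.sum_subset Finset.subset_union_right fun j _ hj => by simp [hwS j hj]
  have hex := fun F : Finset I => exists_posSemidef_kernelSqDist_le_on_finset hk hx hΔ
    (F := F ∪ S) hw0 hw1 (Finset.mem_union_right F ho) (by rw [hsub]; exact hM0)
  choose L hL hLo hLd hLs using hex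
  simp only [hsub] at hLs
  let 𝒰 : Ultrafilter (Finset I) := Ultrafilter.of Filter.atTop
  have hlim : ∀ i j, ∃ a : ℝ, Filter.Tendsto (fun F => L F i j) 𝒰 (nhds a) := by
    intro i j
    set B := (Δ * ‖x i - x o‖ + Δ * ‖x j - x o‖) / 2 with hB
    have hmem : ∀ F, L F i j ∈ Set.Icc (-B) B := fun F => by
      rw [Set.mem_Icc, ← abs_le]
      refine (abs_le_of_posSemidef (hL F) i j).trans ?_
      rw [hB]; linarith [hLo F i, hLo F j]
    obtain ⟨a, -, ha⟩ := (isCompact_Icc (a := -B) (b := B)).ultrafilter_le_nhds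
      (𝒰.map fun F => L F i j) (Filter.le_principal_iff.2
        (show ∀ᶠ F in (𝒰 : Filter (Finset I)), L F i j ∈ Set.Icc (-B) B from
          Filter.Eventually.of_forall hmem))
    exact ⟨a, ha⟩
  choose K hK using hlim
  have hKd : ∀ i j, Filter.Tendsto (fun F => kernelSqDist (L F) i j) 𝒰
      (nhds (kernelSqDist K i j)) := fun i j =>
    ((hK i i).add (hK j j)).sub ((hK i j).const_mul 2)
  refine ⟨K, posSemidef_of_tendsto hL hK, fun i j => ?_, ?_⟩
  · refine le_of_tendsto (hKd i j) ?_
    have h1 : ∀ᶠ F in (𝒰 : Filter (Finset I)), {i, j} ⊆ F :=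
      Ultrafilter.of_le _ (Filter.eventually_ge_atTop ({i, j} : Finset I))
    filter_upwards [h1] with F hF
    exact hLd F i (Finset.mem_union_left _ (hF (by simp))) j
      (Finset.mem_union_left _ (hF (by simp)))
  · refine ge_of_tendsto' (x := (𝒰 : Filter (Finset I))) ?_ hLs
    exact tendsto_finsetSum _ fun i _ => tendsto_finsetSum _ fun j _ => (hKd i j).const_mul _

/-! ### Borel probability measures -/

theorem exists_map_of_finset {I : Type*} {X : Type*}
    [NormedAddCommGroup X] [NormedSpace ℝ X] [FiniteDimensional ℝ X]
    (hk : 2 ≤ Module.finrank ℝ X) (e : I ≃ X) {Δ : ℝ}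
    (hΔ : 2304 * Real.log (Module.finrank ℝ X) < Δ) (S : Finset X) {w : X → ℝ}
    (hw0 : ∀ a, 0 ≤ w a) (hw1 : ∀ a, w a ≤ 1) (hwS : ∀ a ∉ S, w a = 0) :
    ∃ f : X → KernelSum I, (∀ a b, ‖f a - f b‖ ^ 2 ≤ Δ * ‖a - b‖) ∧
      ∑ a ∈ S, ∑ b ∈ S, w a * w b * ‖a - b‖ ≤
        2 * ∑ a ∈ S, ∑ b ∈ S, w a * w b * ‖f a - f b‖ ^ 2 := by
  obtain ⟨K, hK, hKd, hKs⟩ := exists_posSemidef_kernelSqDist_le_of_finset hk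
    (x := e) e.injective hΔ (S.map e.symm.toEmbedding) (w := fun i => w (e i))
    (fun i => hw0 _) (fun i => hw1 _) (fun i hi => hwS _ fun h => hi (by
      simpa using h))
  obtain ⟨φ, hφ⟩ := exists_kernelSum_norm_sub_sq hK
  refine ⟨fun a => φ (e.symm a), fun a b => ?_, ?_⟩
  · rw [hφ]
    simpa using hKd (e.symm a) (e.symm b)
  · simp only [Finset.sum_map, Equiv.coe_toEmbedding, Equiv.apply_symm_apply] at hKs
    simp only [hφ]
    linarith

theorem sq_sqrt_norm_sub_le {X : Type*} [NormedAddCommGroup X] (a b : X) :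
    (√‖a‖ - √‖b‖) ^ 2 ≤ ‖a - b‖ := by
  have ha : √‖a‖ ^ 2 = ‖a‖ := Real.sq_sqrt (norm_nonneg _)
  have hb : √‖b‖ ^ 2 = ‖b‖ := Real.sq_sqrt (norm_nonneg _)
  have ha0 := Real.sqrt_nonneg ‖a‖
  have hb0 := Real.sqrt_nonneg ‖b‖
  have h1 := norm_sub_norm_le a b
  have h2 := norm_sub_norm_le b a
  rw [norm_sub_rev] at h2
  rcases le_total (√‖a‖) (√‖b‖) with h | h <;> nlinarith

/-- For a measure of infinite first moment the map `x ↦ √‖x‖` into a line is good enough: the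
average of the squared distances of its values is infinite. -/
theorem exists_map_of_not_integrable {I : Type*} {X : Type*}
    [NormedAddCommGroup X] [MeasurableSpace X] [OpensMeasurableSpace X]
    [SecondCountableTopology X] (e : I ≃ X) (ν : Measure X) [IsProbabilityMeasure ν]
    (hν : ¬ Integrable (fun x : X => x) ν) :
    ∃ f : X → KernelSum I, (∀ a b, ‖f a - f b‖ ^ 2 ≤ ‖a - b‖) ∧
      ∫⁻ y, ∫⁻ x, ‖f x - f y‖ₑ ^ 2 ∂ν ∂ν = ⊤ := by
  have htop : ∫⁻ x, ‖x‖ₑ ∂ν = ⊤ := by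
    by_contra h
    exact hν ⟨measurable_id.aestronglyMeasurable, lt_top_iff_ne_top.2 h⟩
  set s : I → ℝ := fun i => √‖e i‖ with hs
  have hK : (Matrix.vecMulVec s (star s)).PosSemidef := by
    have h : Matrix.vecMulVec s (star s) = Matrix.gram ℝ s := by
      ext i j
      simp [Matrix.vecMulVec_apply, Matrix.gram_apply, mul_comm]
    rw [h]
    exact posSemidef_gram_of_infinite s
  obtain ⟨φ, hφ⟩ := exists_kernelSum_norm_sub_sq hK
  have hf : ∀ a b, ‖φ (e.symm a) - φ (e.symm b)‖ ^ 2 = (√‖a‖ - √‖b‖) ^ 2 := fun a b => by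
    rw [hφ, kernelSqDist_vecMulVec]; simp [hs]
  refine ⟨fun a => φ (e.symm a), fun a b => (hf a b).trans_le (sq_sqrt_norm_sub_le a b), ?_⟩
  have hinner : ∀ y, ∫⁻ x, ‖φ (e.symm x) - φ (e.symm y)‖ₑ ^ 2 ∂ν = ⊤ := by
    intro y
    have hle : ∀ x : X, ‖x‖ₑ ≤ 2 * ‖φ (e.symm x) - φ (e.symm y)‖ₑ ^ 2 + 2 * ‖y‖ₑ := by
      intro x
      rw [← ofReal_norm, ← ofReal_norm, ← ofReal_norm,
        ← ENNReal.ofReal_pow (norm_nonneg _), hf, ← ENNReal.ofReal_ofNat 2,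
        ← ENNReal.ofReal_mul zero_le_two, ← ENNReal.ofReal_mul zero_le_two,
        ← ENNReal.ofReal_add (by positivity) (by positivity)]
      refine ENNReal.ofReal_le_ofReal ?_
      have hx : √‖x‖ ^ 2 = ‖x‖ := Real.sq_sqrt (norm_nonneg _)
      have hy : √‖y‖ ^ 2 = ‖y‖ := Real.sq_sqrt (norm_nonneg _)
      nlinarith [sq_nonneg (√‖x‖ - 2 * √‖y‖)]
    have h := lintegral_mono (μ := ν) hle
    rw [htop, lintegral_add_right _ measurable_const,
      lintegral_const_mul' _ _ (by norm_num), lintegral_const, measure_univ, mul_one,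
      top_le_iff, ENNReal.add_eq_top] at h
    rcases h with h | h
    · exact (ENNReal.mul_eq_top.1 h).elim (fun h => h.2) fun h => absurd h.1 (by norm_num)
    · exact absurd h (ENNReal.mul_ne_top (by norm_num) enorm_ne_top)
  simp [hinner]

theorem lintegral_lintegral_add_add {X : Type*} [MeasurableSpace X] (ν : Measure X)
    [IsProbabilityMeasure ν] (G : X → X → ENNReal) {a : X → ENNReal} (ha : Measurable a) :
    ∫⁻ y, ∫⁻ x, (G x y + (a x + a y)) ∂ν ∂ν =
      (∫⁻ y, ∫⁻ x, G x y ∂ν ∂ν) + 2 * ∫⁻ x, a x ∂ν := by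
  have h : ∀ y, ∫⁻ x, (G x y + (a x + a y)) ∂ν = ∫⁻ x, G x y ∂ν + (∫⁻ x, a x ∂ν + a y) := by
    intro y
    rw [lintegral_add_right _ (ha.add_const _), lintegral_add_left ha, lintegral_const,
      measure_univ, mul_one]
  simp only [h]
  rw [lintegral_add_right _ (ha.const_add _), lintegral_add_right _ ha, lintegral_const,
    measure_univ, mul_one, two_mul]

theorem lintegral_lintegral_simpleFunc {X : Type*} [MeasurableSpace X] (ν : Measure X)
    [IsProbabilityMeasure ν] (T : SimpleFunc X X) {d : X → X → ℝ} (hd : ∀ a b, 0 ≤ d a b) :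
    ∫⁻ y, ∫⁻ x, ENNReal.ofReal (d (T x) (T y)) ∂ν ∂ν =
      ENNReal.ofReal (∑ a ∈ T.range, ∑ b ∈ T.range,
        ν.real (T ⁻¹' {a}) * ν.real (T ⁻¹' {b}) * d a b) := by
  have hone : ∀ g : X → ENNReal, ∫⁻ x, g (T x) ∂ν = ∑ a ∈ T.range, g a * ν (T ⁻¹' {a}) := by
    intro g
    rw [← SimpleFunc.map_lintegral]
    exact (T.map g).lintegral_eq_lintegral ν
  have hν : ∀ a, ν (T ⁻¹' {a}) = ENNReal.ofReal (ν.real (T ⁻¹' {a})) := fun a =>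
    (ofReal_measureReal).symm
  have hinner : ∀ y, ∫⁻ x, ENNReal.ofReal (d (T x) (T y)) ∂ν =
      ∑ a ∈ T.range, ENNReal.ofReal (d a (T y)) * ν (T ⁻¹' {a}) := fun y =>
    hone fun a => ENNReal.ofReal (d a (T y))
  simp only [hinner]
  refine (hone fun b => ∑ a ∈ T.range, ENNReal.ofReal (d a b) * ν (T ⁻¹' {a})).trans ?_
  simp only [hν, Finset.sum_mul]
  rw [Finset.sum_comm, ENNReal.ofReal_sum_of_nonneg fun a _ => Finset.sum_nonneg fun b _ =>
    mul_nonneg (mul_nonneg measureReal_nonneg measureReal_nonneg) (hd a b)]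
  refine Finset.sum_congr rfl fun a _ => ?_
  rw [ENNReal.ofReal_sum_of_nonneg fun b _ =>
    mul_nonneg (mul_nonneg measureReal_nonneg measureReal_nonneg) (hd a b)]
  refine Finset.sum_congr rfl fun b _ => ?_
  rw [← ENNReal.ofReal_mul (hd a b), ← ENNReal.ofReal_mul
    (mul_nonneg (hd a b) measureReal_nonneg)]
  congr 1; ring

/-- A measure of finite first moment is approximated by the law of a simple function `T`, so
closely that the map which is good for that law is good for the measure itself. -/
theorem exists_map_of_integrable {I : Type*} {X : Type*}
    [NormedAddCommGroup X] [NormedSpace ℝ X] [FiniteDimensional ℝ X] [MeasurableSpace X]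
    [BorelSpace X] (hk : 2 ≤ Module.finrank ℝ X) (e : I ≃ X) {Δ : ℝ}
    (hΔ : 2304 * Real.log (Module.finrank ℝ X) < Δ)
    (ν : Measure X) [IsProbabilityMeasure ν] (hν : Integrable (fun x : X => x) ν) :
    ∃ f : X → KernelSum I, (∀ a b, ‖f a - f b‖ ^ 2 ≤ Δ * ‖a - b‖) ∧
      ∫⁻ y, ∫⁻ x, edist x y ∂ν ∂ν ≤ 16 * ∫⁻ y, ∫⁻ x, ‖f x - f y‖ₑ ^ 2 ∂ν ∂ν := by
  have : ProperSpace X := FiniteDimensional.proper_real X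
  have hΔ0 : 0 < Δ := lt_of_le_of_lt (mul_nonneg (by norm_num)
    (Real.log_natCast_nonneg _)) hΔ
  set M := ∫⁻ y, ∫⁻ x, edist x y ∂ν ∂ν with hM
  have hMtop : M ≠ ⊤ := by
    have h1 : M ≤ ∫⁻ y, ∫⁻ x, (0 + (‖x‖ₑ + ‖y‖ₑ)) ∂ν ∂ν :=
      lintegral_mono fun y => lintegral_mono fun x => by
        simp only [zero_add, edist_eq_enorm_sub]
        exact enorm_sub_le
    rw [lintegral_lintegral_add_add ν (fun _ _ => 0) measurable_enorm] at h1
    refine ne_top_of_le_ne_top ?_ h1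
    simpa using ENNReal.mul_ne_top (by norm_num) hν.2.ne
  rcases eq_or_ne M 0 with hM0 | hM0
  · refine ⟨fun _ => 0, fun a b => ?_, by simp [hM0]⟩
    simpa using mul_nonneg hΔ0.le (norm_nonneg (a - b))
  obtain ⟨T, hT⟩ : ∃ T : SimpleFunc X X,
      ENNReal.ofReal (12 * Δ + 2) * ∫⁻ x, ‖T x - x‖ₑ ∂ν ≤ M / 2 := by
    have h1 := SimpleFunc.tendsto_approxOn_range_L1_enorm (μ := ν) (f := fun x : X => x)
      measurable_id hν
    have h2 := ENNReal.Tendsto.const_mul (a := ENNReal.ofReal (12 * Δ + 2)) h1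
      (Or.inr ENNReal.ofReal_ne_top)
    rw [mul_zero] at h2
    have h3 : (0 : ENNReal) < M / 2 := ENNReal.half_pos hM0
    obtain ⟨n, hn⟩ := (h2.eventually (ge_mem_nhds h3)).exists
    exact ⟨_, hn⟩
  set a : X → ENNReal := fun x => ‖T x - x‖ₑ with ha
  have hameas : Measurable a := (T.measurable.sub measurable_id).enorm
  obtain ⟨f, hf, hfs⟩ := exists_map_of_finset hk e hΔ T.range
    (w := fun b => ν.real (T ⁻¹' {b})) (fun _ => measureReal_nonneg)
    (fun _ => measureReal_le_one) (fun b hb => by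
      have : T ⁻¹' {b} = ∅ := by
        rw [Set.eq_empty_iff_forall_notMem]
        rintro x rfl
        exact hb (T.mem_range_self x)
      simp [this])
  refine ⟨f, hf, ?_⟩
  set J := ∫⁻ y, ∫⁻ x, ‖f x - f y‖ₑ ^ 2 ∂ν ∂ν with hJ
  set MT := ∫⁻ y, ∫⁻ x, ENNReal.ofReal ‖T x - T y‖ ∂ν ∂ν with hMT
  set JT := ∫⁻ y, ∫⁻ x, ENNReal.ofReal (‖f (T x) - f (T y)‖ ^ 2) ∂ν ∂ν with hJT
  have h1 : M ≤ MT + 2 * ∫⁻ x, a x ∂ν := by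
    rw [hMT, ← lintegral_lintegral_add_add ν _ hameas]
    refine lintegral_mono fun y => lintegral_mono fun x => ?_
    simp only [ha, edist_eq_enorm_sub, ofReal_norm]
    have : x - y = (T x - T y) + (-(T x - x) + (T y - y)) := by abel
    rw [this]
    refine (enorm_add_le _ _).trans ?_
    gcongr
    refine (enorm_add_le _ _).trans ?_
    rw [enorm_neg]
  have h2 : MT ≤ 2 * JT := by
    rw [hMT, hJT, lintegral_lintegral_simpleFunc ν T (d := fun a b => ‖a - b‖)
      (fun _ _ => norm_nonneg _),
      lintegral_lintegral_simpleFunc ν T (d := fun a b => ‖f a - f b‖ ^ 2)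
      (fun _ _ => sq_nonneg _)]
    refine (ENNReal.ofReal_le_ofReal hfs).trans_eq ?_
    rw [ENNReal.ofReal_mul zero_le_two, ENNReal.ofReal_ofNat]
  have h3 : JT ≤ 3 * J + 2 * (ENNReal.ofReal (3 * Δ) * ∫⁻ x, a x ∂ν) := by
    have e1 : 3 * J = ∫⁻ y, ∫⁻ x, 3 * ‖f x - f y‖ₑ ^ 2 ∂ν ∂ν := by
      simp only [lintegral_const_mul' (3 : ENNReal) _ (by norm_num)]
      rw [hJ]
    rw [e1, ← lintegral_const_mul _ hameas,
      ← lintegral_lintegral_add_add ν _ (hameas.const_mul _), hJT]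
    refine lintegral_mono fun y => lintegral_mono fun x => ?_
    simp only [ha, ← ofReal_norm]
    rw [← ENNReal.ofReal_pow (norm_nonneg _), ← ENNReal.ofReal_ofNat 3,
      ← ENNReal.ofReal_mul (by norm_num), ← ENNReal.ofReal_mul (by positivity),
      ← ENNReal.ofReal_mul (by positivity), ← ENNReal.ofReal_add (by positivity) (by positivity),
      ← ENNReal.ofReal_add (by positivity) (by positivity)]
    refine ENNReal.ofReal_le_ofReal ?_
    have g1 := hf (T x) x
    have g2 := hf (T y) y
    have g3 : ‖f (T x) - f (T y)‖ ≤ ‖f x - f y‖ + ‖f (T x) - f x‖ + ‖f (T y) - f y‖ := by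
      have : f (T x) - f (T y) = (f x - f y) + (f (T x) - f x) - (f (T y) - f y) := by abel
      rw [this]
      exact (norm_sub_le _ _).trans (add_le_add_left (norm_add_le _ _) _)
    have g4 := pow_le_pow_left₀ (norm_nonneg _) g3 2
    nlinarith [sq_nonneg (‖f x - f y‖ - ‖f (T x) - f x‖),
      sq_nonneg (‖f x - f y‖ - ‖f (T y) - f y‖), sq_nonneg (‖f (T x) - f x‖ - ‖f (T y) - f y‖)]
  have h12 : ENNReal.ofReal (12 * Δ + 2) = 4 * ENNReal.ofReal (3 * Δ) + 2 := by
    rw [show 12 * Δ + 2 = 4 * (3 * Δ) + 2 by ring,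
      ENNReal.ofReal_add (by positivity) (by norm_num),
      ENNReal.ofReal_mul (p := 4) (by norm_num), ENNReal.ofReal_ofNat, ENNReal.ofReal_ofNat]
  have h4 : M / 2 + M / 2 ≤ 6 * J + M / 2 := by
    rw [ENNReal.add_halves]
    calc M ≤ 2 * (3 * J + 2 * (ENNReal.ofReal (3 * Δ) * ∫⁻ x, a x ∂ν)) + 2 * ∫⁻ x, a x ∂ν :=
          h1.trans (by gcongr; exact h2.trans (by gcongr))
      _ = 6 * J + ENNReal.ofReal (12 * Δ + 2) * ∫⁻ x, a x ∂ν := by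
          rw [h12]
          ring
      _ ≤ _ := by gcongr
  have h5 : M / 2 ≤ 6 * J :=
    ENNReal.le_of_add_le_add_right (ENNReal.div_ne_top hMtop (by norm_num)) h4
  calc M = M / 2 + M / 2 := (ENNReal.add_halves M).symm
    _ ≤ 6 * J + 6 * J := add_le_add h5 h5
    _ = 12 * J := by ring
    _ ≤ 16 * J := by gcongr; norm_num

theorem exists_map_of_measure {I : Type*} {X : Type*}
    [NormedAddCommGroup X] [NormedSpace ℝ X] [FiniteDimensional ℝ X] [MeasurableSpace X]
    [BorelSpace X] (hk : 2 ≤ Module.finrank ℝ X) (e : I ≃ X) {Δ : ℝ} (hΔ1 : 1 ≤ Δ)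
    (hΔ : 2304 * Real.log (Module.finrank ℝ X) < Δ) (ν : Measure X) [IsProbabilityMeasure ν] :
    ∃ f : X → KernelSum I, (∀ a b, ‖f a - f b‖ ^ 2 ≤ 16 * Δ * ‖a - b‖) ∧
      ∫⁻ y, ∫⁻ x, edist x y ∂ν ∂ν ≤ ∫⁻ y, ∫⁻ x, ‖f x - f y‖ₑ ^ 2 ∂ν ∂ν := by
  have : ProperSpace X := FiniteDimensional.proper_real X
  by_cases hν : Integrable (fun x : X => x) ν
  · obtain ⟨f, hf, hfs⟩ := exists_map_of_integrable hk e hΔ ν hν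
    refine ⟨fun a => (4 : ℝ) • f a, fun a b => ?_, hfs.trans (le_of_eq ?_)⟩
    · rw [← smul_sub, norm_smul, mul_pow]
      norm_num
      linarith [hf a b]
    · simp only [← smul_sub, enorm_smul, mul_pow]
      have h4 : ‖(4 : ℝ)‖ₑ ^ 2 = 16 := by
        rw [← ofReal_norm, ← ENNReal.ofReal_pow (norm_nonneg _)]
        norm_num
      simp only [h4, lintegral_const_mul' (16 : ENNReal) _ (by norm_num)]
  · obtain ⟨f, hf, hfs⟩ := exists_map_of_not_integrable e ν hν
    refine ⟨f, fun a b => (hf a b).trans ?_, by rw [hfs]; exact le_top⟩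
    nlinarith [norm_nonneg (a - b)]

/-! ### The upper bound -/

theorem embedsWithQuadraticAverageDistortion_halfSnowflake {I : Type*} {X : Type*}
    [NormedAddCommGroup X] [NormedSpace ℝ X] [FiniteDimensional ℝ X]
    (hk : 2 ≤ Module.finrank ℝ X) (e : I ≃ X) :
    EmbedsWithQuadraticAverageDistortion (HalfSnowflake X) (KernelSum I)
      (196 * √(Real.log (Module.finrank ℝ X))) := by
  set l := Real.log (Module.finrank ℝ X) with hl
  have hl2 : 0.69 ≤ l := by
    have : Real.log 2 ≤ l := Real.log_le_log (by norm_num) (by exact_mod_cast hk)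
    linarith [Real.log_two_gt_d9]
  have hsq : √l ^ 2 = l := Real.sq_sqrt (by linarith)
  have hD : 1 ≤ 196 * √l := by
    have : 0.5 ≤ √l := Real.le_sqrt_of_sq_le (by norm_num; linarith)
    linarith
  refine ⟨hD, fun {_ _} μ _ => ?_⟩
  borelize X
  let E : HalfSnowflake X ≃ᵐ X := Metric.Snowflaking.homeomorph.toMeasurableEquiv
  have hν : IsProbabilityMeasure (μ.map E) :=
    Measure.isProbabilityMeasure_map E.measurable.aemeasurable
  obtain ⟨f, hf, hfs⟩ := exists_map_of_measure hk e (Δ := 2401 * l) (by linarith)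
    (by linarith) (μ.map E)
  have hdist : ∀ a b : HalfSnowflake X, dist a b = √‖E a - E b‖ := fun a b => by
    rw [← dist_eq_norm, Real.sqrt_eq_rpow]; rfl
  refine ⟨fun a => f (E a), ?_, ?_⟩
  · refine LipschitzWith.of_dist_le_mul fun a b => ?_
    rw [Real.coe_toNNReal _ (by linarith), hdist, dist_eq_norm]
    refine le_of_sq_le_sq ?_ (by positivity)
    rw [mul_pow, mul_pow, Real.sq_sqrt (norm_nonneg _), hsq]
    linarith [hf (E a) (E b)]
  · have hed : ∀ a b : HalfSnowflake X, edist a b ^ 2 = edist (E a) (E b) := fun a b => by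
      have h : edist a b = edist (E a) (E b) ^ (1 / 2 : ℝ) := rfl
      rw [h, ← ENNReal.rpow_natCast, ← ENNReal.rpow_mul,
        show (1 / 2 : ℝ) * ((2 : ℕ) : ℝ) = 1 by norm_num, ENNReal.rpow_one]
    simp only [lintegral_map_equiv] at hfs
    simpa only [hed] using hfs

/-! ### Fourier analysis on the discrete cube -/

/-- The nontrivial real character of `ℤ/2`. -/
def signChar (z : ZMod 2) : ℝ := if z = 0 then 1 else -1

theorem zmod_two_eq_zero_or_one (z : ZMod 2) : z = 0 ∨ z = 1 := by
  revert z; decide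

theorem signChar_zero : signChar 0 = 1 := by simp [signChar]

theorem signChar_one : signChar 1 = -1 := by simp [signChar]

theorem signChar_add (y z : ZMod 2) : signChar (y + z) = signChar y * signChar z := by
  have h : (1 : ZMod 2) + 1 = 0 := by decide
  rcases zmod_two_eq_zero_or_one y with rfl | rfl <;>
    rcases zmod_two_eq_zero_or_one z with rfl | rfl <;>
    simp [signChar_zero, signChar_one, h]

theorem signChar_mul_self (z : ZMod 2) : signChar z * signChar z = 1 := by
  rw [← signChar_add, CharTwo.add_self_eq_zero, signChar_zero]

section Cube

variable {m : ℕ}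

theorem cube_add_self (a : Fin m → ZMod 2) : a + a = 0 :=
  funext fun i => CharTwo.add_self_eq_zero (a i)

theorem sum_signChar_dotProduct (a : Fin m → ZMod 2) :
    ∑ c : Fin m → ZMod 2, signChar (c ⬝ᵥ a) = if a = 0 then (2 : ℝ) ^ m else 0 := by
  split_ifs with h
  · subst h
    simp [signChar_zero, ZMod.card]
  obtain ⟨i, hi⟩ := Function.ne_iff.1 h
  have hi1 : a i = 1 := (zmod_two_eq_zero_or_one _).resolve_left hi
  have hshift : ∑ c : Fin m → ZMod 2, signChar ((c + Pi.single i 1) ⬝ᵥ a) =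
      ∑ c : Fin m → ZMod 2, signChar (c ⬝ᵥ a) :=
    Equiv.sum_comp (Equiv.addRight (Pi.single i (1 : ZMod 2) : Fin m → ZMod 2))
      fun c => signChar (c ⬝ᵥ a)
  have hneg : ∀ c : Fin m → ZMod 2,
      signChar ((c + Pi.single i 1) ⬝ᵥ a) = -signChar (c ⬝ᵥ a) := fun c => by
    rw [add_dotProduct, single_dotProduct, hi1, one_mul, signChar_add, signChar_one, mul_neg_one]
  simp only [hneg, Finset.sum_neg_distrib] at hshift
  linarith

variable {H : Type*} [NormedAddCommGroup H] [InnerProductSpace ℝ H]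

/-- The (unnormalised) Fourier transform of a Hilbert space valued function on the cube. -/
noncomputable def cubeFourier (w : (Fin m → ZMod 2) → H) (c : Fin m → ZMod 2) : H :=
  ∑ a, signChar (c ⬝ᵥ a) • w a

theorem sum_norm_cubeFourier_sq (w : (Fin m → ZMod 2) → H) :
    ∑ c, ‖cubeFourier w c‖ ^ 2 = 2 ^ m * ∑ a, ‖w a‖ ^ 2 := by
  have hexp : ∀ c, ‖cubeFourier w c‖ ^ 2 =
      ∑ a, ∑ b, signChar (c ⬝ᵥ (a + b)) * inner ℝ (w a) (w b) := by
    intro c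
    rw [← real_inner_self_eq_norm_sq, cubeFourier, sum_inner]
    refine Finset.sum_congr rfl fun a _ => ?_
    rw [inner_sum]
    refine Finset.sum_congr rfl fun b _ => ?_
    rw [real_inner_smul_left, real_inner_smul_right, dotProduct_add, signChar_add]
    ring
  simp only [hexp]
  rw [Finset.sum_comm, Finset.mul_sum]
  refine Finset.sum_congr rfl fun a _ => ?_
  rw [Finset.sum_comm, Finset.sum_eq_single a]
  · rw [← Finset.sum_mul, sum_signChar_dotProduct, if_pos (cube_add_self a),
      real_inner_self_eq_norm_sq]
  · intro b _ hb
    rw [← Finset.sum_mul, sum_signChar_dotProduct, if_neg, zero_mul]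
    intro h
    exact hb (add_left_cancel (h.trans (cube_add_self a).symm))
  · simp

theorem cubeFourier_sub_shift (w : (Fin m → ZMod 2) → H) (g c : Fin m → ZMod 2) :
    cubeFourier (fun a => w a - w (a + g)) c = (1 - signChar (c ⬝ᵥ g)) • cubeFourier w c := by
  have h : ∑ a, signChar (c ⬝ᵥ a) • w (a + g) = signChar (c ⬝ᵥ g) • cubeFourier w c := by
    rw [cubeFourier, Finset.smul_sum,
      ← Equiv.sum_comp (Equiv.addRight g) fun a => signChar (c ⬝ᵥ g) • signChar (c ⬝ᵥ a) • w a]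
    refine Finset.sum_congr rfl fun a _ => ?_
    rw [Equiv.coe_addRight, dotProduct_add, signChar_add, smul_smul, mul_left_comm,
      signChar_mul_self, mul_one]
  simp only [cubeFourier, smul_sub, Finset.sum_sub_distrib, sub_smul, one_smul]
  rw [h, cubeFourier]

theorem sum_sum_norm_sub_sq_cube (w : (Fin m → ZMod 2) → H) :
    ∑ a, ∑ b, ‖w a - w b‖ ^ 2 = 2 * ∑ c with c ≠ 0, ‖cubeFourier w c‖ ^ 2 := by
  have h0 : cubeFourier w 0 = ∑ a, w a := by simp [cubeFourier, signChar_zero]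
  have h1 : ∑ c, ‖cubeFourier w c‖ ^ 2 =
      ‖∑ a, w a‖ ^ 2 + ∑ c with c ≠ 0, ‖cubeFourier w c‖ ^ 2 := by
    rw [← Finset.sum_filter_add_sum_filter_not _ (fun c : Fin m → ZMod 2 => c = 0)]
    simp [Finset.filter_eq', h0]
  have h2 : ∑ a, ∑ b, ‖w a - w b‖ ^ 2 = 2 * (2 ^ m * ∑ a, ‖w a‖ ^ 2) - 2 * ‖∑ a, w a‖ ^ 2 := by
    have h3 : ‖∑ a, w a‖ ^ 2 = ∑ a, ∑ b, inner ℝ (w a) (w b) := by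
      rw [← real_inner_self_eq_norm_sq, sum_inner]
      exact Finset.sum_congr rfl fun a _ => inner_sum _ _ _
    simp only [norm_sub_sq_real, Finset.sum_add_distrib, Finset.sum_sub_distrib, h3,
      Finset.sum_const, Finset.card_univ, ← Finset.mul_sum, Fintype.card_pi, ZMod.card,
      Finset.prod_const, Fintype.card_fin, nsmul_eq_mul]
    push_cast
    ring
  rw [h2, ← sum_norm_cubeFourier_sq, h1]
  ring

/-- **Poincaré inequality on a Cayley graph of the cube.** The hypothesis says that every
nontrivial character equals `-1` on at least `s` of the generators `g i`. -/
theorem sum_sum_norm_sub_sq_le_of_generators {ι : Type*} [Fintype ι] (g : ι → Fin m → ZMod 2)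
    {s : ℕ} (hg : ∀ c : Fin m → ZMod 2, c ≠ 0 → s ≤ Finset.card {i | c ⬝ᵥ g i = 1})
    (w : (Fin m → ZMod 2) → H) :
    2 * s * ∑ a, ∑ b, ‖w a - w b‖ ^ 2 ≤ 2 ^ m * ∑ i, ∑ a, ‖w a - w (a + g i)‖ ^ 2 := by
  have h1 : ∀ i, 2 ^ m * ∑ a, ‖w a - w (a + g i)‖ ^ 2 =
      ∑ c, (1 - signChar (c ⬝ᵥ g i)) ^ 2 * ‖cubeFourier w c‖ ^ 2 := fun i => by
    rw [← sum_norm_cubeFourier_sq fun a => w a - w (a + g i)]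
    refine Finset.sum_congr rfl fun c _ => ?_
    rw [cubeFourier_sub_shift, norm_smul, mul_pow, Real.norm_eq_abs, sq_abs]
  have h2 : ∀ c i, (1 - signChar (c ⬝ᵥ g i)) ^ 2 = if c ⬝ᵥ g i = 1 then 4 else 0 := by
    intro c i
    rcases zmod_two_eq_zero_or_one (c ⬝ᵥ g i) with h | h <;> rw [h]
    · simp [signChar_zero]
    · rw [signChar_one]; norm_num
  rw [sum_sum_norm_sub_sq_cube, Finset.mul_sum Finset.univ, Finset.sum_congr rfl fun i _ => h1 i,
    Finset.sum_comm, Finset.mul_sum, Finset.mul_sum]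
  refine (Finset.sum_le_sum fun c hc => ?_).trans (Finset.sum_le_sum_of_subset_of_nonneg
    (Finset.subset_univ _) fun c _ _ => Finset.sum_nonneg fun i _ =>
      mul_nonneg (sq_nonneg _) (sq_nonneg _))
  rw [← Finset.sum_mul]
  simp only [h2]
  have h3 : ∑ i, (if c ⬝ᵥ g i = 1 then (4 : ℝ) else 0) =
      4 * (Finset.card {i | c ⬝ᵥ g i = 1} : ℝ) := by
    rw [← Finset.sum_filter, Finset.sum_const, nsmul_eq_mul, mul_comm]
  rw [h3]
  have h4 : (s : ℝ) ≤ Finset.card {i | c ⬝ᵥ g i = 1} := by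
    exact_mod_cast hg c (Finset.mem_filter.1 hc).2
  nlinarith [mul_le_mul_of_nonneg_right h4 (sq_nonneg ‖cubeFourier w c‖)]

/-- A random choice of `8 m` generators works: by an exponential moment bound the
probability that a given nontrivial character equals `-1` on fewer than `m` of them is below
`2 ^ (-m)`. -/
theorem exists_generators (hm : m ≠ 0) : ∃ g : Fin (8 * m) → Fin m → ZMod 2,
    ∀ c : Fin m → ZMod 2, c ≠ 0 → m ≤ Finset.card {i | c ⬝ᵥ g i = 1} := by
  by_contra! hcon
  let φ : (Fin m → ZMod 2) → (Fin m → ZMod 2) → ℝ := fun c h => if c ⬝ᵥ h = 1 then 1 / 4 else 1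
  have hφ0 : ∀ c h, 0 ≤ φ c h := fun c h => by simp only [φ]; split_ifs <;> norm_num
  have hφ : ∀ c, c ≠ 0 → ∑ h, φ c h = 5 / 8 * 2 ^ m := by
    intro c hc
    have h1 : ∀ h, φ c h = 5 / 8 + 3 / 8 * signChar (h ⬝ᵥ c) := fun h => by
      simp only [φ]
      rw [dotProduct_comm h c]
      rcases zmod_two_eq_zero_or_one (c ⬝ᵥ h) with h | h <;> rw [h]
      · rw [signChar_zero]; norm_num
      · rw [signChar_one]; norm_num
    simp only [h1, Finset.sum_add_distrib, ← Finset.mul_sum, sum_signChar_dotProduct, hc,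
      if_false, Finset.sum_const, Finset.card_univ, Fintype.card_pi, ZMod.card,
      Finset.prod_const, Fintype.card_fin, nsmul_eq_mul]
    push_cast
    ring
  have hprod : ∀ (c : Fin m → ZMod 2) (g : Fin (8 * m) → Fin m → ZMod 2),
      ∏ i, φ c (g i) = (1 / 4) ^ Finset.card {i | c ⬝ᵥ g i = 1} := by
    intro c g
    simp only [φ, Finset.prod_ite, Finset.prod_const, one_pow, mul_one]
  have hupper : ∑ g : Fin (8 * m) → Fin m → ZMod 2, ∑ c with c ≠ 0, ∏ i, φ c (g i) ≤
      2 ^ m * (5 / 8 * 2 ^ m) ^ (8 * m) := by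
    rw [Finset.sum_comm]
    calc ∑ c with c ≠ 0, ∑ g : Fin (8 * m) → Fin m → ZMod 2, ∏ i, φ c (g i)
        = ∑ c : Fin m → ZMod 2 with c ≠ 0, ((5 : ℝ) / 8 * 2 ^ m) ^ (8 * m) :=
          Finset.sum_congr rfl fun c hc => by
            rw [← Fintype.sum_pow, hφ c (Finset.mem_filter.1 hc).2]
      _ ≤ ∑ c : Fin m → ZMod 2, ((5 : ℝ) / 8 * 2 ^ m) ^ (8 * m) :=
          Finset.sum_le_sum_of_subset_of_nonneg (Finset.subset_univ _)
            fun _ _ _ => by positivity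
      _ = _ := by simp [ZMod.card]
  have hlower : (2 ^ m : ℝ) ^ (8 * m) * (1 / 4) ^ m ≤
      ∑ g : Fin (8 * m) → Fin m → ZMod 2, ∑ c with c ≠ 0, ∏ i, φ c (g i) := by
    calc (2 ^ m : ℝ) ^ (8 * m) * (1 / 4) ^ m
        = ∑ g : Fin (8 * m) → Fin m → ZMod 2, (1 / 4 : ℝ) ^ m := by simp [ZMod.card]
      _ ≤ _ := Finset.sum_le_sum fun g _ => by
          obtain ⟨c, hc, hcard⟩ := hcon g
          refine le_trans ?_ (Finset.single_le_sum (f := fun c => ∏ i, φ c (g i))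
            (fun c _ => Finset.prod_nonneg fun i _ => hφ0 _ _)
            (Finset.mem_filter.2 ⟨Finset.mem_univ c, hc⟩))
          simp only [hprod]
          exact pow_le_pow_of_le_one (by norm_num) (by norm_num) hcard.le
  have h2 := hlower.trans hupper
  rw [mul_pow, mul_comm ((5 / 8 : ℝ) ^ (8 * m)), mul_left_comm] at h2
  have h3 := le_of_mul_le_mul_left h2 (by positivity)
  rw [pow_mul, ← mul_pow] at h3
  exact absurd h3 (not_le.2 (pow_lt_pow_left₀ (by norm_num) (by norm_num) hm))

end Cube

/-! ### Truncated word length -/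

/-- The length of `a` with respect to the generators `g`, truncated at `r`. In characteristic two
a word in the generators is a subset of the index set. -/
noncomputable def truncLength {ι G : Type*} [AddCommGroup G] (g : ι → G) (r : ℕ) (a : G) : ℕ :=
  sInf {j | j = r ∨ ∃ s : Finset ι, s.card ≤ j ∧ ∑ i ∈ s, g i = a}

section TruncLength

variable {ι G : Type*} [AddCommGroup G] (g : ι → G) (r : ℕ)

theorem truncLength_le (a : G) : truncLength g r a ≤ r := Nat.sInf_le (Or.inl rfl)

theorem truncLength_zero : truncLength g r 0 = 0 :=
  Nat.eq_zero_of_le_zero (Nat.sInf_le (Or.inr ⟨∅, by simp, by simp⟩))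

theorem exists_sum_eq_of_truncLength_lt {a : G} (h : truncLength g r a < r) :
    ∃ s : Finset ι, s.card ≤ truncLength g r a ∧ ∑ i ∈ s, g i = a := by
  have hmem : truncLength g r a ∈
      {j | j = r ∨ ∃ s : Finset ι, s.card ≤ j ∧ ∑ i ∈ s, g i = a} := Nat.sInf_mem ⟨r, Or.inl rfl⟩
  exact hmem.resolve_left h.ne

theorem truncLength_add_le (h2 : ∀ a : G, a + a = 0) (a : G) (i : ι) :
    truncLength g r (a + g i) ≤ truncLength g r a + 1 := by
  classical
  rcases (truncLength_le g r a).eq_or_lt with h | h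
  · rw [h]
    exact (truncLength_le g r _).trans (Nat.le_succ r)
  obtain ⟨s, hs, rfl⟩ := exists_sum_eq_of_truncLength_lt g r h
  refine Nat.sInf_le (Or.inr ?_)
  by_cases hi : i ∈ s
  · refine ⟨s.erase i, (Finset.card_erase_le.trans hs).trans (Nat.le_succ _), ?_⟩
    rw [← Finset.sum_erase_add s g hi, add_assoc, h2, add_zero]
  · refine ⟨insert i s, (Finset.card_insert_le _ _).trans (Nat.succ_le_succ hs), ?_⟩
    rw [Finset.sum_insert hi, add_comm]

theorem abs_truncLength_sub_le (h2 : ∀ a : G, a + a = 0) (a : G) (i : ι) :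
    |(truncLength g r a : ℝ) - truncLength g r (a + g i)| ≤ 1 := by
  have h3 := truncLength_add_le g r h2 a i
  have h4 := truncLength_add_le g r h2 (a + g i) i
  rw [add_assoc, h2, add_zero] at h4
  have h3' : (truncLength g r (a + g i) : ℝ) ≤ truncLength g r a + 1 := by exact_mod_cast h3
  have h4' : (truncLength g r a : ℝ) ≤ truncLength g r (a + g i) + 1 := by exact_mod_cast h4
  rw [abs_le]
  constructor <;> linarith

theorem card_truncLength_lt_le [Fintype ι] [Fintype G] :
    Finset.card {a | truncLength g r a < r} ≤
      Finset.card {s : Finset ι | s.card < r} := by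
  classical
  refine (Finset.card_le_card fun a ha => ?_).trans
    (Finset.card_image_le (f := fun s : Finset ι => ∑ i ∈ s, g i))
  have h := (Finset.mem_filter.1 ha).2
  obtain ⟨s, hs, rfl⟩ := exists_sum_eq_of_truncLength_lt g r h
  exact Finset.mem_image.2 ⟨s, Finset.mem_filter.2 ⟨Finset.mem_univ _, hs.trans_lt h⟩, rfl⟩

end TruncLength

/-- Words of length less than `r` in `96 r` letters make up at most half of `2 ^ (12 r)`. -/
theorem card_finset_card_lt_le {r : ℕ} (hr : r ≠ 0) :
    2 * (Finset.card {s : Finset (Fin (8 * (12 * r))) | s.card < r} : ℝ) ≤ 2 ^ (12 * r) := by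
  have h1 : (Finset.card {s : Finset (Fin (8 * (12 * r))) | s.card < r} : ℝ) * (1 / 64) ^ r ≤
      (65 / 64) ^ (8 * (12 * r)) := by
    have h2 := Fintype.sum_pow_mul_eq_add_pow (Fin (8 * (12 * r))) (1 / 64 : ℝ) 1
    simp only [one_pow, mul_one, Fintype.card_fin] at h2
    calc _ = ∑ s : Finset (Fin (8 * (12 * r))) with s.card < r, (1 / 64 : ℝ) ^ r := by
          rw [Finset.sum_const, nsmul_eq_mul]
      _ ≤ ∑ s : Finset (Fin (8 * (12 * r))) with s.card < r, (1 / 64 : ℝ) ^ s.card :=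
          Finset.sum_le_sum fun s hs => pow_le_pow_of_le_one (by norm_num) (by norm_num)
            (Finset.mem_filter.1 hs).2.le
      _ ≤ ∑ s : Finset (Fin (8 * (12 * r))), (1 / 64 : ℝ) ^ s.card :=
          Finset.sum_le_sum_of_subset_of_nonneg (Finset.subset_univ _)
            fun _ _ _ => by positivity
      _ = _ := by rw [h2]; norm_num
  have h3 : (65 / 64 : ℝ) ^ (8 * (12 * r)) ≤ 32 ^ r := by
    rw [← mul_assoc, pow_mul]
    exact pow_le_pow_left₀ (by norm_num) (by norm_num) r
  have h4 : (2 : ℝ) ^ (12 * r) = 64 ^ r * (32 ^ r * 2 ^ r) := by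
    rw [pow_mul, ← mul_pow, ← mul_pow]; norm_num
  have h5 : (2 : ℝ) ≤ 2 ^ r := le_self_pow₀ (by norm_num) hr
  have h6 := h1.trans h3
  rw [one_div, inv_pow, ← div_eq_mul_inv, div_le_iff₀ (by positivity)] at h6
  rw [h4]
  have h7 : (0 : ℝ) ≤ 32 ^ r * 64 ^ r := by positivity
  nlinarith [mul_le_mul_of_nonneg_left h5 h7]

/-! ### The lower bound -/

/-- An embedding with quadratic average distortion, tested on the uniform distribution of a finite
family of points. -/
theorem EmbedsWithQuadraticAverageDistortion.exists_sum_sum_le {M Z : Type*} [MetricSpace M]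
    [NormedAddCommGroup Z] {D : ℝ} (h : EmbedsWithQuadraticAverageDistortion M Z D)
    {G : Type*} [Fintype G] [Nonempty G] (p : G → M) :
    ∃ f : M → Z, LipschitzWith D.toNNReal f ∧
      ∑ a, ∑ b, dist (p a) (p b) ^ 2 ≤ ∑ a, ∑ b, ‖f (p a) - f (p b)‖ ^ 2 := by
  borelize M
  set n : ENNReal := ((Fintype.card G : ℕ) : ENNReal) with hn
  have hn0 : n ≠ 0 := by simp [hn]
  have hntop : n ≠ ⊤ := by simp [hn]
  set μ : Measure M := n⁻¹ • ∑ a, Measure.dirac (p a) with hμ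
  have hint : ∀ F : M → ENNReal, ∫⁻ x, F x ∂μ = n⁻¹ * ∑ a, F (p a) := fun F => by
    rw [hμ, lintegral_smul_measure, lintegral_finsetSum_measure]
    simp [lintegral_dirac]
  have hprob : IsProbabilityMeasure μ := ⟨by
    rw [← lintegral_one, hint]
    simp only [Finset.sum_const, Finset.card_univ, nsmul_eq_mul, mul_one]
    exact ENNReal.inv_mul_cancel hn0 hntop⟩
  obtain ⟨f, hf, hfs⟩ := h.2 μ
  refine ⟨f, hf, ?_⟩
  simp only [hint] at hfs
  simp only [← Finset.mul_sum] at hfs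
  have hinv0 : n⁻¹ ≠ 0 := ENNReal.inv_ne_zero.2 hntop
  have hinvtop : n⁻¹ ≠ ⊤ := ENNReal.inv_ne_top.2 hn0
  rw [ENNReal.mul_le_mul_iff_right hinv0 hinvtop, ENNReal.mul_le_mul_iff_right hinv0 hinvtop]
    at hfs
  have hconv : ∀ d : G → G → ℝ, ∑ b, ∑ a, ENNReal.ofReal (d a b ^ 2) =
      ENNReal.ofReal (∑ a, ∑ b, d a b ^ 2) := fun d => by
    rw [Finset.sum_comm, ENNReal.ofReal_sum_of_nonneg fun a _ =>
      Finset.sum_nonneg fun b _ => sq_nonneg _]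
    exact Finset.sum_congr rfl fun a _ =>
      (ENNReal.ofReal_sum_of_nonneg fun b _ => sq_nonneg _).symm
  simp only [edist_dist, ← ofReal_norm, ← ENNReal.ofReal_pow dist_nonneg,
    ← ENNReal.ofReal_pow (norm_nonneg _)] at hfs
  rw [hconv fun a b => dist (p a) (p b), hconv fun a b => ‖f (p a) - f (p b)‖] at hfs
  exact (ENNReal.ofReal_le_ofReal_iff (Finset.sum_nonneg fun a _ => Finset.sum_nonneg fun b _ =>
    sq_nonneg _)).1 hfs

/-- An expanding Cayley graph on `2 ^ (12 r)` vertices, drawn in `ℓ_∞` by translates of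
its truncated word length. -/
theorem natCast_le_mul_sq_of_embeds {k r : ℕ} (hr : r ≠ 0) (hk : 2 ^ (12 * r) ≤ k) {H : Type*}
    [NormedAddCommGroup H] [InnerProductSpace ℝ H] {D : ℝ}
    (h : EmbedsWithQuadraticAverageDistortion (HalfSnowflake (Fin k → ℝ)) H D) :
    (r : ℝ) ≤ 8 * D ^ 2 := by
  have hD0 : 0 ≤ D := zero_le_one.trans h.1
  set m := 12 * r with hm
  have hm0 : m ≠ 0 := by omega
  obtain ⟨g, hg⟩ := exists_generators hm0
  let ℓ : (Fin m → ZMod 2) → ℕ := truncLength g r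
  have h2 : ∀ a : Fin m → ZMod 2, a + a = 0 := cube_add_self
  obtain ⟨π, hπ⟩ : ∃ π : Fin k → Fin m → ZMod 2, Function.Surjective π := by
    obtain ⟨e⟩ := Function.Embedding.nonempty_of_card_le
      (α := Fin m → ZMod 2) (β := Fin k) (by simpa [ZMod.card] using hk)
    exact ⟨Function.invFun e, Function.invFun_surjective e.injective⟩
  let x : (Fin m → ZMod 2) → Fin k → ℝ := fun a j => ℓ (a + π j)
  have hstep : ∀ a i, ‖x a - x (a + g i)‖ ≤ 1 := by
    intro a i
    refine (pi_norm_le_iff_of_nonneg zero_le_one).2 fun j => ?_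
    have := abs_truncLength_sub_le g r h2 (a + π j) i
    rw [add_right_comm] at this
    exact this
  have hfar : ∀ a b, (ℓ (a + b) : ℝ) ≤ ‖x a - x b‖ := by
    intro a b
    obtain ⟨j, rfl⟩ := hπ b
    refine le_trans ?_ (norm_le_pi_norm _ j)
    have h0 : ℓ 0 = 0 := truncLength_zero g r
    simp [x, h2, h0]
  have hsumℓ : ∀ a, ∑ b, (ℓ (a + b) : ℝ) = ∑ b, (ℓ b : ℝ) := fun a =>
    Equiv.sum_comp (Equiv.addLeft a) fun b => (ℓ b : ℝ)
  have hℓ : (2 : ℝ) ^ m * r ≤ 2 * ∑ b, (ℓ b : ℝ) := by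
    have hcard : 2 * (Finset.card {a | ℓ a < r} : ℝ) ≤ 2 ^ m := by
      have h3 : (Finset.card {a | ℓ a < r} : ℝ) ≤
          Finset.card {s : Finset (Fin (8 * m)) | s.card < r} := by
        exact_mod_cast card_truncLength_lt_le g r
      linarith [card_finset_card_lt_le hr]
    have hpt : ∀ b, (r : ℝ) - (if ℓ b < r then (r : ℝ) else 0) ≤ ℓ b := fun b => by
      split_ifs with hb
      · simp
      · simpa using hb
    have h4 := Finset.sum_le_sum fun b (_ : b ∈ Finset.univ) => hpt b
    rw [Finset.sum_sub_distrib, ← Finset.sum_filter, Finset.sum_const, Finset.sum_const,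
      Finset.card_univ] at h4
    simp only [Fintype.card_pi, ZMod.card, Finset.prod_const, Finset.card_univ, Fintype.card_fin,
      nsmul_eq_mul] at h4
    push_cast at h4
    nlinarith [mul_le_mul_of_nonneg_right hcard (Nat.cast_nonneg (α := ℝ) r)]
  obtain ⟨f, hf, hfs⟩ := h.exists_sum_sum_le fun a => Metric.Snowflaking.toSnowflaking (x a)
  set w : (Fin m → ZMod 2) → H := fun a => f (Metric.Snowflaking.toSnowflaking (x a)) with hw
  have hdist : ∀ a b, dist (Metric.Snowflaking.toSnowflaking (x a) : HalfSnowflake (Fin k → ℝ))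
      (Metric.Snowflaking.toSnowflaking (x b)) ^ 2 = ‖x a - x b‖ := fun a b => by
    rw [Metric.Snowflaking.dist_toSnowflaking_toSnowflaking, ← Real.sqrt_eq_rpow,
      Real.sq_sqrt dist_nonneg, dist_eq_norm]
  have hedge : ∀ a i, ‖w a - w (a + g i)‖ ^ 2 ≤ D ^ 2 := by
    intro a i
    have h5 := hf.dist_le_mul (Metric.Snowflaking.toSnowflaking (x a))
      (Metric.Snowflaking.toSnowflaking (x (a + g i)))
    rw [Real.coe_toNNReal D hD0, dist_eq_norm] at h5
    have h6 := pow_le_pow_left₀ (norm_nonneg _) h5 2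
    rw [mul_pow, hdist] at h6
    exact h6.trans (mul_le_of_le_one_right (sq_nonneg D) (hstep a i))
  have hP := sum_sum_norm_sub_sq_le_of_generators g hg w
  have hE : ∑ i, ∑ a, ‖w a - w (a + g i)‖ ^ 2 ≤ 8 * m * 2 ^ m * D ^ 2 := by
    refine (Finset.sum_le_sum fun i _ => Finset.sum_le_sum fun a _ => hedge a i).trans ?_
    simp [ZMod.card]
    linarith
  have hlow : (2 : ℝ) ^ m * (2 ^ m * r) ≤ 2 * ∑ a, ∑ b, ‖w a - w b‖ ^ 2 := by
    have h7 : ∑ a, ∑ b, (ℓ (a + b) : ℝ) ≤ ∑ a, ∑ b, ‖w a - w b‖ ^ 2 := by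
      refine le_trans ?_ hfs
      simp only [hdist]
      exact Finset.sum_le_sum fun a _ => Finset.sum_le_sum fun b _ => hfar a b
    simp only [hsumℓ, Finset.sum_const, Finset.card_univ, Fintype.card_pi, ZMod.card,
      Finset.prod_const, Fintype.card_fin, nsmul_eq_mul] at h7
    push_cast at h7
    have h8 := mul_le_mul_of_nonneg_left hℓ (by positivity : (0 : ℝ) ≤ 2 ^ m)
    linarith
  have hm1 : (0 : ℝ) < m := by exact_mod_cast Nat.pos_of_ne_zero hm0
  have hn : (0 : ℝ) < 2 ^ m := by positivity
  have h9 : (m * 2 ^ m * 2 ^ m : ℝ) * r ≤ (m * 2 ^ m * 2 ^ m : ℝ) * (8 * D ^ 2) := by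
    have := mul_le_mul_of_nonneg_left hE hn.le
    have := mul_le_mul_of_nonneg_left hlow hm1.le
    linarith
  exact le_of_mul_le_mul_left h9 (by positivity)

theorem sqrt_log_le_of_embeds {k : ℕ} (hk : 2 ≤ k) {H : Type*} [NormedAddCommGroup H]
    [InnerProductSpace ℝ H] {D : ℝ}
    (h : EmbedsWithQuadraticAverageDistortion (HalfSnowflake (Fin k → ℝ)) H D) :
    1 / 14 * √(Real.log k) ≤ D := by
  set r := Nat.log 2 k / 12 with hr
  have hk0 : k ≠ 0 := by omega
  have hlog : Real.log k ≤ 12 * (r + 1) := by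
    have h1 : k < 2 ^ (12 * (r + 1)) :=
      (Nat.lt_pow_succ_log_self one_lt_two k).trans_le
        (Nat.pow_le_pow_right zero_lt_two (by omega))
    have h2 : (k : ℝ) ≤ 2 ^ (12 * (r + 1)) := by exact_mod_cast h1.le
    have h3 := Real.log_le_log (by exact_mod_cast Nat.pos_of_ne_zero hk0) h2
    rw [Real.log_pow] at h3
    push_cast at h3
    nlinarith [Real.log_two_lt_d9, (Nat.cast_nonneg r : (0 : ℝ) ≤ r)]
  have hD := h.1
  have hbound : Real.log k ≤ (14 * D) ^ 2 := by
    rcases eq_or_ne r 0 with h0 | h0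
    · rw [h0] at hlog
      norm_num at hlog
      nlinarith
    · have h4 := natCast_le_mul_sq_of_embeds h0
        ((Nat.pow_le_pow_right zero_lt_two (by omega)).trans (Nat.pow_log_le_self 2 hk0)) h
      have h5 : (1 : ℝ) ≤ r := by exact_mod_cast Nat.one_le_iff_ne_zero.2 h0
      nlinarith
  have := Real.sqrt_le_left (by linarith) |>.2 hbound
  linarith

theorem theorem1 :
    (∃ C : ℝ, 0 < C ∧ ∀ k : ℕ, 2 ≤ k →
      ∀ (X : Type u) [NormedAddCommGroup X] [NormedSpace ℝ X], Module.finrank ℝ X = k →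
        ∃ (H : Type) (_ : NormedAddCommGroup H) (_ : InnerProductSpace ℝ H) (_ : CompleteSpace H),
          EmbedsWithQuadraticAverageDistortion (HalfSnowflake X) H
            (C * Real.sqrt (Real.log k))) ∧
    (∃ c : ℝ, 0 < c ∧ ∀ k : ℕ, 2 ≤ k →
      -- `Fin k → ℝ` carries the supremum norm
      ∀ (H : Type v) [NormedAddCommGroup H] [InnerProductSpace ℝ H] [CompleteSpace H] (D : ℝ),
        EmbedsWithQuadraticAverageDistortion (HalfSnowflake (Fin k → ℝ)) H D →
          c * Real.sqrt (Real.log k) ≤ D) := by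
  refine ⟨⟨196, by norm_num, fun k hk X _ _ hX => ?_⟩, ⟨1 / 14, by norm_num, ?_⟩⟩
  · have hfin : FiniteDimensional ℝ X := FiniteDimensional.of_finrank_pos (by omega)
    let e : (Fin k → ℝ) ≃ X := (Module.finBasisOfFinrankEq ℝ X hX).equivFun.symm.toEquiv
    refine ⟨KernelSum (Fin k → ℝ), inferInstance, inferInstance, inferInstance, ?_⟩
    have h := embedsWithQuadraticAverageDistortion_halfSnowflake (hX.symm ▸ hk) e
    rwa [hX] at h
  · intro k hk H _ _ _ D h
    exact sqrt_log_le_of_embeds hk h
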